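/- Let $\mathcal X$ be a real Banach space that is smooth, i.e. its norm is Gâteaux differentiable at every $\mathbf x\neq \mathbf 0$. Write $\mathrm{SGN}_{\mathbf x}\in\mathcal X^*$ for the Gâteaux derivative of the norm at $\mathbf x\ne \mathbf 0$, i.e. $\mathrm{SGN}_{\mathbf x}(\mathbf h)=\lim_{t\to0}t^{-1}(\|\mathbf x+t\mathbf h\|-\|\mathbf x\|)$ for all $\mathbf h\in\mathcal X$, and put $\mathrm{SGN}_{\mathbf 0}=\mathbf 0$. Assume that the dual space $\mathcal X^*$ (with its norm) is separable and of type $2$: there is a constant $b>0$ such that $E\|\sum_{i=1}^n \mathbf U_i\|^2\le b\sum_{i=1}^n E\|\mathbf U_i\|^2$ for all $n\geq 1$ and all independent zero-mean random elements $\mathbf U_1,\dots,\mathbf U_n$ of $\mathcal X^*$ with $E\|\mathbf U_i\|^2<\infty$ for every $i$. Let $P$ and $Q$ be any two Borel probability measures on $\mathcal X$, and let $\mathbf X\sim P$ and $\mathbf Y\sim Q$ be independent. Put $\mu=E(\mathrm{SGN}_{\mathbf Y-\mathbf X})\in\mathcal X^*$ (Bochner expectation) and, for $\mathbf f,\mathbf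 g\in\mathcal X^{**}$, $$\Gamma_1(\mathbf f,\mathbf g)=E\big[\mathbf f\{E(\mathrm{SGN}_{\mathbf Y-\mathbf X}\mid\mathbf X)\}\,\mathbf g\{E(\mathrm{SGN}_{\mathbf Y-\mathbf X}\mid\mathbf X)\}\big]-\mathbf f(\mu)\mathbf g(\mu),$$ $$\Gamma_2(\mathbf f,\mathbf g)=E\big[\mathbf f\{E(\mathrm{SGN}_{\mathbf Y-\mathbf X}\mid\mathbf Y)\}\,\mathbf g\{E(\mathrm{SGN}_{\mathbf Y-\mathbf X}\mid\mathbf Y)\}\big]-\mathbf f(\mu)\mathbf g(\mu).$$ For independent observations $\mathbf X_1,\dots,\mathbf X_m$ from $P$ and $\mathbf Y_1,\dots,\mathbf Y_n$ from $Q$ (the two samples also being independent of each other), let $T_{WMW}=(mn)^{-1}\sum_{i=1}^m\sum_{j=1}^n \mathrm{SGN}_{\mathbf Y_j-\mathbf X_i}$ and $N=m+n$. If $m,n\to\infty$ in such a way that $m/N\to\gamma\in(0,1)$, then there is a Gaussian distribution $G\{\mathbf 0,(1-\gamma)\Gamma_1+\gamma\Gamma_2\}$ on $\mathcal X^*$ with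 mean $\mathbf 0$ and covariance $(1-\gamma)\Gamma_1+\gamma\Gamma_2$, and $(mn/N)^{1/2}(T_{WMW}-\mu)$ converges weakly in $\mathcal X^*$ (with its norm topology) to it. -/

import Mathlib

open MeasureTheory ProbabilityTheory Filter Topology

universe u v

/-- `L` is the Gâteaux derivative at `x` of the norm of `E`:
`(‖x + t • h‖ - ‖x‖) / t → L h` as `t → 0`, for every direction `h`. -/
def IsGateauxDerivNorm {E : Type u} [NormedAddCommGroup E] [NormedSpace ℝ E]
    (L : StrongDual ℝ E) (x : E) : Prop :=
  ∀ h : E, HasLineDerivAt ℝ (fun z : E => ‖z‖) (L h) x h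

/-- A normed space is smooth if its norm is Gâteaux differentiable at every nonzero point. -/
def IsSmoothSpace (E : Type u) [NormedAddCommGroup E] [NormedSpace ℝ E] : Prop :=
  ∀ x : E, x ≠ 0 → ∃ L : StrongDual ℝ E, IsGateauxDerivNorm L x

open Classical in
/-- The spatial sign `SGN x`: the Gâteaux derivative of the norm at `x` if `x ≠ 0`, and `0` if
`x = 0` (also `0`, by convention, at points where the norm is not Gâteaux differentiable; there are
none in a smooth space). -/
noncomputable def SGN {E : Type u} [NormedAddCommGroup E] [NormedSpace ℝ E] (x : E) :
    StrongDual ℝ E :=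
  if h : x ≠ 0 ∧ ∃ L : StrongDual ℝ E, IsGateauxDerivNorm L x then h.2.choose else 0

/-- `F` is of type 2: there is `b > 0` such that `E ‖∑ Uᵢ‖² ≤ b ∑ E ‖Uᵢ‖²` for all finite families
of independent, centered random elements of `F` with finite second moments. -/
def IsTypeTwo (F : Type u) [NormedAddCommGroup F] [NormedSpace ℝ F] [MeasurableSpace F]
    [BorelSpace F] : Prop :=
  ∃ b : ℝ, 0 < b ∧
    ∀ (Ω : Type u) [MeasurableSpace Ω] (ρ : Measure Ω) [IsProbabilityMeasure ρ]
      (n : ℕ) (U : Fin n → Ω → F),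
      iIndepFun U ρ → (∀ i, MemLp (U i) 2 ρ) → (∀ i, ∫ ω, U i ω ∂ρ = 0) →
        ∫ ω, ‖∑ i, U i ω‖ ^ 2 ∂ρ ≤ b * ∑ i, ∫ ω, ‖U i ω‖ ^ 2 ∂ρ

/-- `G` is the Gaussian distribution on `F` with mean `a` and covariance `C`. -/
structure IsGaussianWith {F : Type u} [NormedAddCommGroup F] [NormedSpace ℝ F] [MeasurableSpace F]
    (G : Measure F) (a : F) (C : StrongDual ℝ F → StrongDual ℝ F → ℝ) : Prop where
  isGaussian : IsGaussian G
  integrable : Integrable (fun w : F => w) G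
  mean_eq : ∫ w, w ∂G = a
  covariance_eq : ∀ f g : StrongDual ℝ F, cov[fun w => f w, fun w => g w; G] = C f g

section WMW

variable {E : Type u} [NormedAddCommGroup E] [NormedSpace ℝ E]

/-- The Wilcoxon–Mann–Whitney statistic `(mn)⁻¹ ∑ᵢ ∑ⱼ SGN (yⱼ - xᵢ)`. -/
noncomputable def wmwStat {m n : ℕ} (x : Fin m → E) (y : Fin n → E) : StrongDual ℝ E :=
  ((m : ℝ) * (n : ℝ))⁻¹ • ∑ i, ∑ j, SGN (y j - x i)

variable [MeasurableSpace E]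

/-- `E (SGN (Y - X))` for independent `X ∼ P` and `Y ∼ Q`, realized as the two coordinates of the
product space `E × E` with the measure `P ⊗ Q`. -/
noncomputable def wmwMean (P Q : Measure E) : StrongDual ℝ E :=
  ∫ z, SGN (z.2 - z.1) ∂(P.prod Q)

/-- The conditional expectation `E (SGN (Y - X) ∣ X)`, for `X ∼ P` and `Y ∼ Q` the coordinates of
`(E × E, P ⊗ Q)`. -/
noncomputable def condSGNLeft (P Q : Measure E) : E × E → StrongDual ℝ E :=
  (P.prod Q)[fun z => SGN (z.2 - z.1) | MeasurableSpace.comap Prod.fst inferInstance]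

/-- The conditional expectation `E (SGN (Y - X) ∣ Y)`, for `X ∼ P` and `Y ∼ Q` the coordinates of
`(E × E, P ⊗ Q)`. -/
noncomputable def condSGNRight (P Q : Measure E) : E × E → StrongDual ℝ E :=
  (P.prod Q)[fun z => SGN (z.2 - z.1) | MeasurableSpace.comap Prod.snd inferInstance]

/-- The covariance of `E (SGN (Y - X) ∣ X)`. -/
noncomputable def Gamma₁ (P Q : Measure E) (f g : StrongDual ℝ (StrongDual ℝ E)) : ℝ :=
  (∫ z, f (condSGNLeft P Q z) * g (condSGNLeft P Q z) ∂(P.prod Q))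
    - f (wmwMean P Q) * g (wmwMean P Q)

/-- The covariance of `E (SGN (Y - X) ∣ Y)`. -/
noncomputable def Gamma₂ (P Q : Measure E) (f g : StrongDual ℝ (StrongDual ℝ E)) : ℝ :=
  (∫ z, f (condSGNRight P Q z) * g (condSGNRight P Q z) ∂(P.prod Q))
    - f (wmwMean P Q) * g (wmwMean P Q)

end WMW

/-!
`T_WMW` is a two-sample U-statistic with the kernel `h (x, y) = SGN (y - x)`, which is bounded, and
measurable because the dual is separable. By the Hoeffding decomposition,
`h (x, y) = μ + h₁ x + h₂ y + r (x, y)` with `h₁`, `h₂` centered and `r` centered in each variable.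
Applying the type 2 inequality to one sample with the other one fixed, and then to the other sample,
shows that the mean of `r` over the two samples is of order `(mn)^(-1/2)` in `L²`, so that it
disappears in the limit after multiplication by `(mn/N)^(1/2)`. What is left, the Hájek projection,
is a combination of two independent normalized sums with coefficients tending to `(1 - γ)^(1/2)` and
`γ^(1/2)`. Each of them converges by the central limit theorem in spaces of type 2: its
one-dimensional marginals converge, and it is tight, since the summands are `L²`-approximated by
centered simple functions, whose normalized sums stay in a finite-dimensional space, while the
type 2 inequality controls the error uniformly in the sample size.
-/

section Tightness

theorem isCompact_iInter_cthickening {F ι : Type*} [PseudoMetricSpace F] [CompleteSpace F]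
    {K : ι → Set F} {δ : ι → ℝ} {l : Filter ι} [l.NeBot] (hK : ∀ j, TotallyBounded (K j))
    (hδ : Tendsto δ l (𝓝 0)) : IsCompact (⋂ j, Metric.cthickening (δ j) (K j)) := by
  refine TotallyBounded.isCompact_of_isClosed ?_
    (isClosed_iInter fun j => Metric.isClosed_cthickening)
  rw [Metric.totallyBounded_iff]
  intro η hη
  obtain ⟨j, hj⟩ := (hδ.eventually_lt_const (half_pos hη)).exists
  obtain ⟨t, ht, htK⟩ := Metric.totallyBounded_iff.1 (hK j) (η / 2) (half_pos hη)
  refine ⟨t, ht, fun x hx => ?_⟩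
  obtain ⟨y, hy, hxy⟩ := Metric.mem_thickening_iff.1
    (Metric.cthickening_subset_thickening' (half_pos hη) hj (K j) (Set.mem_iInter.1 hx j))
  obtain ⟨z, hz, hyz⟩ := Set.mem_iUnion₂.1 (htK hy)
  refine Set.mem_iUnion₂.2 ⟨z, hz, ?_⟩
  rw [Metric.mem_ball] at hyz ⊢
  linarith [dist_triangle x y z]

theorem isTightMeasureSet_of_forall_cthickening {F : Type*} [PseudoMetricSpace F] [CompleteSpace F]
    [MeasurableSpace F] {S : Set (Measure F)}
    (h : ∀ ε : ℝ, 0 < ε → ∃ K : Set F, IsCompact K ∧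
      ∀ μ ∈ S, μ (Metric.cthickening ε K)ᶜ ≤ ENNReal.ofReal ε) :
    IsTightMeasureSet S := by
  rw [isTightMeasureSet_iff_exists_isCompact_measure_compl_le]
  intro ε hε
  obtain ⟨δ, hδ0, hδ⟩ := ENNReal.exists_pos_sum_of_countable hε.ne' ℕ
  have hδ_tendsto : Tendsto (fun j => (δ j : ℝ)) atTop (𝓝 0) := by
    exact (ENNReal.tsum_coe_ne_top_iff_summable_coe.1 hδ.ne_top).tendsto_atTop_zero
  choose K hK hKS using fun j : ℕ => h (δ j) (by exact_mod_cast hδ0 j)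
  refine ⟨_, isCompact_iInter_cthickening (fun j => (hK j).totallyBounded) hδ_tendsto,
    fun μ hμ => ?_⟩
  calc μ (⋂ j, Metric.cthickening (δ j) (K j))ᶜ
      ≤ ∑' j, μ (Metric.cthickening (δ j) (K j))ᶜ := by
        rw [Set.compl_iInter]
        exact measure_iUnion_le _
    _ ≤ ∑' j, (δ j : ENNReal) := ENNReal.tsum_le_tsum fun j => by simpa using hKS j μ hμ
    _ ≤ ε := hδ.le

variable {F : Type*} [NormedAddCommGroup F] [NormedSpace ℝ F] [CompleteSpace F]
  [SecondCountableTopology F] [MeasurableSpace F] [BorelSpace F]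

theorem ext_of_map_strongDual {μ ν : Measure F} [IsFiniteMeasure μ] [IsFiniteMeasure ν]
    (h : ∀ L : StrongDual ℝ F, μ.map L = ν.map L) : μ = ν := by
  refine Measure.ext_of_charFunDual (funext fun L => ?_)
  rw [charFunDual_eq_charFun_map_one, charFunDual_eq_charFun_map_one, h L]

theorem exists_tendsto_of_isTightMeasureSet_of_tendsto_map {ι : Type*} {l : Filter ι} [l.NeBot]
    {μ : ι → ProbabilityMeasure F} {ν : StrongDual ℝ F → ProbabilityMeasure ℝ}
    (hμ : IsTightMeasureSet (Set.range fun i => (μ i : Measure F)))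
    (hν : ∀ L : StrongDual ℝ F,
      Tendsto (fun i => (μ i).map L.continuous.measurable.aemeasurable) l (𝓝 (ν L))) :
    ∃ G : ProbabilityMeasure F,
      (∀ L : StrongDual ℝ F, (G : Measure F).map L = ν L) ∧ Tendsto μ l (𝓝 G) := by
  have hcompact : IsCompact (closure (Set.range μ)) :=
    isCompact_closure_of_isTightMeasureSet <| hμ.subset <| by
      rintro _ ⟨_, ⟨i, rfl⟩, rfl⟩
      exact ⟨i, rfl⟩
  have hcluster : ∀ U : Ultrafilter ι, (U : Filter ι) ≤ l → ∃ G : ProbabilityMeasure F,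
      (∀ L : StrongDual ℝ F, (G : Measure F).map L = ν L) ∧ Tendsto μ U (𝓝 G) := by
    intro U hU
    obtain ⟨G, -, hG : Tendsto μ U (𝓝 G)⟩ := hcompact.ultrafilter_le_nhds (U.map μ)
      (tendsto_principal.2 (.of_forall fun i => subset_closure (Set.mem_range_self i)))
    refine ⟨G, fun L => ?_, hG⟩
    exact congrArg ProbabilityMeasure.toMeasure <| tendsto_nhds_unique
      (ProbabilityMeasure.tendsto_map_of_tendsto_of_continuous _ _ hG L.continuous)
      ((hν L).mono_left hU)
  obtain ⟨G, hG, -⟩ := hcluster (Ultrafilter.of l) (Ultrafilter.of_le l)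
  refine ⟨G, hG, (tendsto_iff_ultrafilter _ _ _).2 fun U hU => ?_⟩
  obtain ⟨G', hG', hlim⟩ := hcluster U hU
  have hGG' : G = G' := Subtype.ext <|
    ext_of_map_strongDual (μ := G.toMeasure) (ν := G'.toMeasure) fun L =>
      (hG L).trans (hG' L).symm
  rwa [hGG']

end Tightness

section Gaussian

theorem covariance_add_prod {Ω Ω' : Type*} [MeasurableSpace Ω] [MeasurableSpace Ω']
    {μ : Measure Ω} {ν : Measure Ω'} [IsProbabilityMeasure μ] [IsProbabilityMeasure ν]
    {X X' : Ω → ℝ} {Y Y' : Ω' → ℝ} (hX : MemLp X 2 μ) (hX' : MemLp X' 2 μ) (hY : MemLp Y 2 ν)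
    (hY' : MemLp Y' 2 ν) :
    cov[fun z : Ω × Ω' => X z.1 + Y z.2, fun z => X' z.1 + Y' z.2; μ.prod ν]
      = cov[X, X'; μ] + cov[Y, Y'; ν] := by
  have hfst : cov[fun z : Ω × Ω' => X z.1, fun z => X' z.1; μ.prod ν] = cov[X, X'; μ] := by
    conv_rhs => rw [← (measurePreserving_fst (μ := μ) (ν := ν)).map_eq]
    exact (covariance_map_fun (by simpa using hX.1) (by simpa using hX'.1) (by fun_prop)).symm
  have hsnd : cov[fun z : Ω × Ω' => Y z.2, fun z => Y' z.2; μ.prod ν] = cov[Y, Y'; ν] := by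
    conv_rhs => rw [← (measurePreserving_snd (μ := μ) (ν := ν)).map_eq]
    exact (covariance_map_fun (by simpa using hY.1) (by simpa using hY'.1) (by fun_prop)).symm
  have hindep : ∀ {U : Ω → ℝ} {V : Ω' → ℝ}, MemLp U 2 μ → MemLp V 2 ν →
      cov[fun z : Ω × Ω' => U z.1, fun z => V z.2; μ.prod ν] = 0 := fun hU hV =>
    (indepFun_prod₀ hU.aemeasurable hV.aemeasurable).covariance_eq_zero (hU.comp_fst ν)
      (hV.comp_snd μ)
  change cov[(fun z : Ω × Ω' => X z.1) + fun z => Y z.2, (fun z => X' z.1) + fun z => Y' z.2; _] = _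
  rw [covariance_add_left (hX.comp_fst ν) (hY.comp_snd μ)
      ((hX'.comp_fst ν).add (hY'.comp_snd μ)),
    covariance_add_right (hX.comp_fst ν) (hX'.comp_fst ν) (hY'.comp_snd μ),
    covariance_add_right (hY.comp_snd μ) (hX'.comp_fst ν) (hY'.comp_snd μ), hfst, hsnd,
    hindep hX hY', covariance_comm (fun z : Ω × Ω' => Y z.2), hindep hX' hY]
  ring

variable {F : Type*} [NormedAddCommGroup F] [NormedSpace ℝ F] [CompleteSpace F]
  [SecondCountableTopology F] [MeasurableSpace F] [BorelSpace F]

theorem isGaussianWith_zero_of_map_eq_gaussianReal_variance {Ω : Type*} [MeasurableSpace Ω]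
    {ρ : Measure Ω} [IsProbabilityMeasure ρ] {V : Ω → F} (hV : MemLp V 2 ρ) {G : Measure F}
    (hG : ∀ L : StrongDual ℝ F, G.map L = gaussianReal 0 Var[fun ω => L (V ω); ρ].toNNReal) :
    IsGaussianWith G 0 fun f g => cov[fun ω => f (V ω), fun ω => g (V ω); ρ] := by
  have hgauss : IsGaussian G := isGaussian_of_map_eq_gaussianReal fun L => ⟨_, _, hG L⟩
  have hmean : ∀ L : StrongDual ℝ F, ∫ w, L w ∂G = 0 := fun L => by
    rw [← integral_map (φ := L) (f := fun t => t) (by fun_prop) (by fun_prop), hG L,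
      integral_id_gaussianReal]
  have hvar : ∀ L : StrongDual ℝ F, Var[L; G] = Var[fun ω => L (V ω); ρ] := fun L => by
    rw [← Function.id_comp (L : F → ℝ), ← variance_map (by fun_prop) (by fun_prop), hG L,
      variance_id_gaussianReal, Real.coe_toNNReal _ (variance_nonneg _ _)]
    rfl
  refine ⟨hgauss, IsGaussian.integrable_id, ?_, fun f g => ?_⟩
  · refine SeparatingDual.eq_zero_of_forall_dual_eq_zero (R := ℝ) fun L => ?_
    exact (L.integral_comp_comm IsGaussian.integrable_id).symm.trans (hmean L)
  · have polarG := variance_add (IsGaussian.memLp_dual G f 2 (by simp))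
      (IsGaussian.memLp_dual G g 2 (by simp))
    have polarV := variance_add (f.comp_memLp' hV) (g.comp_memLp' hV)
    have hfg : Var[⇑f + ⇑g; G] = Var[⇑f ∘ V + ⇑g ∘ V; ρ] := hvar (f + g)
    have hf : Var[f; G] = Var[⇑f ∘ V; ρ] := hvar f
    have hg : Var[g; G] = Var[⇑g ∘ V; ρ] := hvar g
    simp only [Function.comp_def] at hf hg hfg polarV
    change cov[f, g; G] = _
    linarith

theorem IsGaussianWith.map_smul_add_smul {G G' : Measure F} {a a' : F}
    {C C' : StrongDual ℝ F → StrongDual ℝ F → ℝ} (hG : IsGaussianWith G a C)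
    (hG' : IsGaussianWith G' a' C') (s t : ℝ) :
    IsGaussianWith ((G.prod G').map fun p => s • p.1 + t • p.2) (s • a + t • a')
      fun f g => s ^ 2 * C f g + t ^ 2 * C' f g := by
  have := hG.isGaussian
  have := hG'.isGaussian
  set T : F × F →L[ℝ] F :=
    s • ContinuousLinearMap.fst ℝ F F + t • ContinuousLinearMap.snd ℝ F F
  change IsGaussianWith ((G.prod G').map T) _ _
  refine ⟨inferInstance, IsGaussian.integrable_id, ?_, fun f g => ?_⟩
  · rw [integral_map (by fun_prop) (by fun_prop)]
    have hs : Integrable (fun p : F × F => s • p.1) (G.prod G') :=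
      (hG.integrable.comp_fst G').smul s
    have ht : Integrable (fun p : F × F => t • p.2) (G.prod G') :=
      (hG'.integrable.comp_snd G).smul t
    calc ∫ p, T p ∂(G.prod G') = ∫ p, s • p.1 ∂(G.prod G') + ∫ p, t • p.2 ∂(G.prod G') :=
          integral_add hs ht
      _ = s • a + t • a' := by
          rw [integral_smul, integral_smul, integral_fun_fst (fun w : F => w),
            integral_fun_snd (fun w : F => w), hG.mean_eq, hG'.mean_eq, probReal_univ,
            probReal_univ, one_smul, one_smul]
  · have hGL : ∀ L : StrongDual ℝ F, MemLp (fun w => s * L w) 2 G := fun L =>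
      (IsGaussian.memLp_dual G L 2 (by simp)).const_mul s
    have hGL' : ∀ L : StrongDual ℝ F, MemLp (fun w => t * L w) 2 G' := fun L =>
      (IsGaussian.memLp_dual G' L 2 (by simp)).const_mul t
    have hT : ∀ L : StrongDual ℝ F, (fun p => L (T p)) = fun p => s * L p.1 + t * L p.2 :=
      fun L => by
        ext p
        simp [T]
    rw [covariance_map_fun (by fun_prop) (by fun_prop) (by fun_prop), hT, hT,
      covariance_add_prod (hGL f) (hGL g) (hGL' f) (hGL' g)]
    simp only [covariance_const_mul_left, covariance_const_mul_right, hG.covariance_eq,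
      hG'.covariance_eq]
    ring

end Gaussian

section SquareIntegrable

variable {Ω F : Type*} [MeasurableSpace Ω] [NormedAddCommGroup F] {μ : Measure Ω} {f : Ω → F}

theorem measure_le_norm_le_ofReal_integral_norm_sq_div (hf : MemLp f 2 μ) {ε : ℝ} (hε : 0 < ε) :
    μ {ω | ε ≤ ‖f ω‖} ≤ ENNReal.ofReal ((∫ ω, ‖f ω‖ ^ 2 ∂μ) / ε ^ 2) := by
  have hint : Integrable (fun ω => ‖f ω‖ ^ 2) μ := hf.integrable_norm_pow (by norm_num)
  have hset : {ω | ε ≤ ‖f ω‖} = {ω | ε ^ 2 ≤ ‖f ω‖ ^ 2} := by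
    ext ω
    exact (sq_le_sq₀ hε.le (norm_nonneg _)).symm
  have hmarkov := mul_meas_ge_le_integral_of_nonneg (ae_of_all μ fun ω => sq_nonneg ‖f ω‖) hint
    (ε ^ 2)
  rw [hset, ← ofReal_measureReal (hint.measure_ge_lt_top (by positivity)).ne]
  exact ENNReal.ofReal_le_ofReal <| (le_div_iff₀' (by positivity)).2 hmarkov

theorem integral_norm_sq_eq_toReal_eLpNorm_sq (hf : MemLp f 2 μ) :
    ∫ ω, ‖f ω‖ ^ 2 ∂μ = (eLpNorm f 2 μ).toReal ^ 2 := by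
  have hnonneg : 0 ≤ ∫ ω, ‖f ω‖ ^ 2 ∂μ := integral_nonneg fun ω => sq_nonneg _
  rw [hf.eLpNorm_eq_integral_rpow_norm (by simp) (by simp)]
  simp only [ENNReal.toReal_ofNat, Real.rpow_ofNat]
  rw [ENNReal.toReal_ofReal (by positivity), ← one_div, ← Real.sqrt_eq_rpow,
    Real.sq_sqrt hnonneg]

variable [NormedSpace ℝ F] [IsProbabilityMeasure μ] {p : ENNReal}

theorem eLpNorm_sub_integral_le (hp : 1 ≤ p) (hf : AEStronglyMeasurable f μ) :
    eLpNorm (fun ω => f ω - ∫ ω', f ω' ∂μ) p μ ≤ 2 * eLpNorm f p μ := by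
  have hmean : ‖∫ ω, f ω ∂μ‖ₑ ≤ eLpNorm f p μ :=
    calc ‖∫ ω, f ω ∂μ‖ₑ ≤ eLpNorm f 1 μ := by
          rw [eLpNorm_one_eq_lintegral_enorm]
          exact enorm_integral_le_lintegral_enorm f
      _ ≤ eLpNorm f p μ := eLpNorm_le_eLpNorm_of_exponent_le hp hf
  calc eLpNorm (fun ω => f ω - ∫ ω', f ω' ∂μ) p μ
      ≤ eLpNorm f p μ + eLpNorm (fun _ => ∫ ω', f ω' ∂μ) p μ :=
        eLpNorm_sub_le hf aestronglyMeasurable_const hp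
    _ ≤ eLpNorm f p μ + eLpNorm f p μ := by
        gcongr
        simpa [eLpNorm_const _ (zero_lt_one.trans_le hp).ne' (IsProbabilityMeasure.ne_zero μ)]
          using hmean
    _ = 2 * eLpNorm f p μ := (two_mul _).symm

theorem exists_simpleFunc_integral_eq_zero_eLpNorm_sub_lt [CompleteSpace F] (hp : 1 ≤ p)
    (hp_top : p ≠ ⊤) (hf : MemLp f p μ) (h0 : ∫ ω, f ω ∂μ = 0) {ε : ENNReal} (hε : ε ≠ 0) :
    ∃ g : SimpleFunc Ω F, MemLp g p μ ∧ ∫ ω, g ω ∂μ = 0 ∧ eLpNorm (f - ⇑g) p μ < ε := by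
  obtain ⟨s, hs, hs_mem⟩ := hf.exists_simpleFunc_eLpNorm_sub_lt hp_top
    (ENNReal.half_pos hε).ne'
  have hf_int := hf.integrable hp
  have hs_int := hs_mem.integrable hp
  refine ⟨s - SimpleFunc.const Ω (∫ ω, s ω ∂μ), ?_, ?_, ?_⟩
  · rw [SimpleFunc.coe_sub]
    exact hs_mem.sub (memLp_const _)
  · simp only [SimpleFunc.coe_sub, Pi.sub_apply, SimpleFunc.const_apply]
    rw [integral_sub hs_int (integrable_const _)]
    simp
  · have hcenter : f - ⇑(s - SimpleFunc.const Ω (∫ ω, s ω ∂μ))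
        = fun ω => (f - ⇑s) ω - ∫ ω', (f - ⇑s) ω' ∂μ := by
      ext ω
      simp only [Pi.sub_apply, SimpleFunc.coe_sub, SimpleFunc.const_apply,
        integral_sub hf_int hs_int, h0]
      abel
    calc eLpNorm (f - ⇑(s - SimpleFunc.const Ω (∫ ω, s ω ∂μ))) p μ
        ≤ 2 * eLpNorm (f - ⇑s) p μ := by
          rw [hcenter]
          exact eLpNorm_sub_integral_le hp (hf.1.sub hs_mem.1)
      _ < 2 * (ε / 2) := by gcongr; simp
      _ = ε := ENNReal.mul_div_cancel two_ne_zero (by simp)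

theorem exists_simpleFunc_integral_eq_zero_integral_norm_sub_sq_le [CompleteSpace F]
    (hf : MemLp f 2 μ) (h0 : ∫ ω, f ω ∂μ = 0) {δ : ℝ} (hδ : 0 < δ) :
    ∃ g : SimpleFunc Ω F, MemLp g 2 μ ∧ ∫ ω, g ω ∂μ = 0 ∧ ∫ ω, ‖f ω - g ω‖ ^ 2 ∂μ ≤ δ := by
  obtain ⟨g, hg, hg0, hlt⟩ := exists_simpleFunc_integral_eq_zero_eLpNorm_sub_lt one_le_two
    ENNReal.ofNat_ne_top hf h0 (ENNReal.ofReal_pos.2 (Real.sqrt_pos.2 hδ)).ne'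
  refine ⟨g, hg, hg0, ?_⟩
  calc ∫ ω, ‖f ω - g ω‖ ^ 2 ∂μ = (eLpNorm (f - ⇑g) 2 μ).toReal ^ 2 :=
        integral_norm_sq_eq_toReal_eLpNorm_sq (hf.sub hg)
    _ ≤ √δ ^ 2 := by
        gcongr
        exact ENNReal.toReal_le_of_le_ofReal (Real.sqrt_nonneg δ) hlt.le
    _ = δ := Real.sq_sqrt hδ.le

theorem exists_simpleFunc_comp_integral_eq_zero_integral_norm_sub_sq_le [CompleteSpace F]
    [SecondCountableTopology F] [MeasurableSpace F] [BorelSpace F] (hf : MemLp f 2 μ)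
    (h0 : ∫ ω, f ω ∂μ = 0) {δ : ℝ} (hδ : 0 < δ) :
    ∃ g : SimpleFunc F F, MemLp (g ∘ f) 2 μ ∧ ∫ ω, g (f ω) ∂μ = 0 ∧
      ∫ ω, ‖f ω - g (f ω)‖ ^ 2 ∂μ ≤ δ := by
  have hfm := hf.aemeasurable
  have : IsProbabilityMeasure (μ.map f) := Measure.isProbabilityMeasure_map hfm
  obtain ⟨g, hg, hg0, hgδ⟩ := exists_simpleFunc_integral_eq_zero_integral_norm_sub_sq_le
    ((memLp_map_measure_iff aestronglyMeasurable_id hfm).2 hf)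
    ((integral_map hfm aestronglyMeasurable_id).trans h0) hδ
  refine ⟨g, hg.comp_of_map hfm, ?_, ?_⟩
  · rwa [integral_map hfm g.measurable.aestronglyMeasurable] at hg0
  · have hgm : Measurable fun x => x - g x := measurable_id.sub g.measurable
    exact (integral_map hfm (hgm.norm.pow_const 2).aestronglyMeasurable).symm.trans_le hgδ

end SquareIntegrable

/-- The type 2 inequality of `IsTypeTwo` with the constant `b`. -/
def HasTypeTwoConstant (F : Type u) [NormedAddCommGroup F] [NormedSpace ℝ F] [MeasurableSpace F]
    (b : ℝ) : Prop :=
  ∀ (Ω : Type u) [MeasurableSpace Ω] (ρ : Measure Ω) [IsProbabilityMeasure ρ]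
    (n : ℕ) (U : Fin n → Ω → F),
    iIndepFun U ρ → (∀ i, MemLp (U i) 2 ρ) → (∀ i, ∫ ω, U i ω ∂ρ = 0) →
      ∫ ω, ‖∑ i, U i ω‖ ^ 2 ∂ρ ≤ b * ∑ i, ∫ ω, ‖U i ω‖ ^ 2 ∂ρ

/-- The sum of the first `m` terms of a sequence of random elements, divided by `√m` as in the
central limit theorem (it is `0` for `m = 0`). -/
noncomputable def normalizedSum {Ω F : Type*} [AddCommGroup F] [Module ℝ F] (X : ℕ → Ω → F) (m : ℕ)
    (ω : Ω) : F :=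
  (√(m : ℝ))⁻¹ • ∑ i ∈ Finset.range m, X i ω

theorem aemeasurable_normalizedSum {Ω F : Type*} [MeasurableSpace Ω] {ρ : Measure Ω}
    [AddCommGroup F] [Module ℝ F] [MeasurableSpace F] [MeasurableAdd₂ F] [MeasurableConstSMul ℝ F]
    {X : ℕ → Ω → F} (hX : ∀ i, AEMeasurable (X i) ρ) (m : ℕ) :
    AEMeasurable (normalizedSum X m) ρ :=
  (Finset.aemeasurable_fun_sum _ fun i _ => hX i).const_smul _

section TypeTwo

variable {F : Type u} [NormedAddCommGroup F] [NormedSpace ℝ F] [MeasurableSpace F] [BorelSpace F]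
  {b : ℝ} {Ω : Type*} [MeasurableSpace Ω] {ρ : Measure Ω}
  [IsProbabilityMeasure ρ] {X : ℕ → Ω → F}

theorem tendstoInDistribution_dual_normalizedSum [CompleteSpace F] (hindep : iIndepFun X ρ)
    (hident : ∀ i, IdentDistrib (X i) (X 0) ρ ρ) (hX : MemLp (X 0) 2 ρ)
    (h0 : ∫ ω, X 0 ω ∂ρ = 0) (L : StrongDual ℝ F) :
    TendstoInDistribution (fun m ω => L (normalizedSum X m ω)) atTop (id : ℝ → ℝ) (fun _ => ρ)
      (gaussianReal 0 Var[fun ω => L (X 0 ω); ρ].toNNReal) := by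
  have hLX : MemLp (fun ω => L (X 0 ω)) 2 ρ := L.comp_memLp' hX
  have hmean : ∫ ω, L (X 0 ω) ∂ρ = 0 := by
    rw [L.integral_comp_comm (hX.integrable one_le_two), h0, map_zero]
  have hclt := tendstoInDistribution_inv_sqrt_mul_sum_sub (X := fun i ω => L (X i ω)) HasLaw.id hLX
    (hindep.comp (fun _ => L) fun _ => L.continuous.measurable)
    (fun i => (hident i).comp L.continuous.measurable)
  simpa [normalizedSum, hmean] using hclt

variable [SecondCountableTopology F]

-- The laws of the summands live on `F` itself, so replacing `Ω` by `Fin n → F` makes the type 2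
-- inequality available on probability spaces of any universe.
theorem HasTypeTwoConstant.integral_norm_sum_sq_le (hF : HasTypeTwoConstant F b) {n : ℕ}
    {U : Fin n → Ω → F} (hindep : iIndepFun U ρ) (hU : ∀ i, MemLp (U i) 2 ρ)
    (h0 : ∀ i, ∫ ω, U i ω ∂ρ = 0) :
    ∫ ω, ‖∑ i, U i ω‖ ^ 2 ∂ρ ≤ b * ∑ i, ∫ ω, ‖U i ω‖ ^ 2 ∂ρ := by
  have hUm : ∀ i, AEMeasurable (U i) ρ := fun i => (hU i).aemeasurable
  set ν : Fin n → Measure F := fun i => ρ.map (U i)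
  have hprob : ∀ i, IsProbabilityMeasure (ν i) := fun i =>
    Measure.isProbabilityMeasure_map (hUm i)
  have hlaw : HasLaw (fun ω i => U i ω) (Measure.pi ν) ρ :=
    hindep.hasLaw_pi fun i => ⟨hUm i, rfl⟩
  have hmem : ∀ i, MemLp (fun w : Fin n → F => w i) 2 (Measure.pi ν) := fun i =>
    ((memLp_map_measure_iff aestronglyMeasurable_id (hUm i)).2 (hU i)).comp_measurePreserving
      (measurePreserving_eval ν i)
  have hnorm : ∀ i, ∫ w, ‖w i‖ ^ 2 ∂Measure.pi ν = ∫ ω, ‖U i ω‖ ^ 2 ∂ρ := fun i =>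
    (hlaw.integral_comp (f := fun w => ‖w i‖ ^ 2)
      ((measurable_pi_apply i).norm.pow_const 2).aestronglyMeasurable).symm
  have hsum : ∫ w, ‖∑ i, w i‖ ^ 2 ∂Measure.pi ν = ∫ ω, ‖∑ i, U i ω‖ ^ 2 ∂ρ :=
    (hlaw.integral_comp (f := fun w => ‖∑ i, w i‖ ^ 2) (by fun_prop)).symm
  have hmean : ∀ i, ∫ w, w i ∂Measure.pi ν = 0 := fun i =>
    (hlaw.integral_comp (f := fun w => w i)
      (measurable_pi_apply i).aestronglyMeasurable).symm.trans (h0 i)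
  simpa only [hnorm, hsum] using hF (Fin n → F) (Measure.pi ν) n (fun i w => w i)
    (iIndepFun_pi fun i => aemeasurable_id) hmem hmean

theorem HasTypeTwoConstant.integral_norm_sum_range_sq_le (hF : HasTypeTwoConstant F b)
    (hindep : iIndepFun X ρ) (hident : ∀ i, IdentDistrib (X i) (X 0) ρ ρ) (hX : MemLp (X 0) 2 ρ)
    (h0 : ∫ ω, X 0 ω ∂ρ = 0) (m : ℕ) :
    ∫ ω, ‖∑ i ∈ Finset.range m, X i ω‖ ^ 2 ∂ρ ≤ b * (m * ∫ ω, ‖X 0 ω‖ ^ 2 ∂ρ) := by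
  have hnorm : ∀ i, ∫ ω, ‖X i ω‖ ^ 2 ∂ρ = ∫ ω, ‖X 0 ω‖ ^ 2 ∂ρ := fun i =>
    ((hident i).comp (measurable_norm.pow_const 2)).integral_eq
  simpa [hnorm, Finset.sum_range] using hF.integral_norm_sum_sq_le
    (hindep.precomp (Fin.val_injective (n := m))) (fun i => (hident i).memLp_iff.2 hX)
    (fun i => (hident i).integral_eq.trans h0)

theorem HasTypeTwoConstant.integral_norm_normalizedSum_sq_le (hF : HasTypeTwoConstant F b)
    (hb : 0 ≤ b) (hindep : iIndepFun X ρ) (hident : ∀ i, IdentDistrib (X i) (X 0) ρ ρ)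
    (hX : MemLp (X 0) 2 ρ) (h0 : ∫ ω, X 0 ω ∂ρ = 0) (m : ℕ) :
    ∫ ω, ‖normalizedSum X m ω‖ ^ 2 ∂ρ ≤ b * ∫ ω, ‖X 0 ω‖ ^ 2 ∂ρ := by
  rcases m.eq_zero_or_pos with rfl | hm
  · simpa [normalizedSum] using mul_nonneg hb (integral_nonneg fun ω => sq_nonneg ‖X 0 ω‖)
  have hm' : (0 : ℝ) < m := by exact_mod_cast hm
  calc ∫ ω, ‖normalizedSum X m ω‖ ^ 2 ∂ρ
      = (m : ℝ)⁻¹ * ∫ ω, ‖∑ i ∈ Finset.range m, X i ω‖ ^ 2 ∂ρ := by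
        simp only [normalizedSum, norm_smul, norm_inv, Real.norm_eq_abs, mul_pow, inv_pow, sq_abs,
          Real.sq_sqrt hm'.le, integral_const_mul]
    _ ≤ (m : ℝ)⁻¹ * (b * (m * ∫ ω, ‖X 0 ω‖ ^ 2 ∂ρ)) := by
        gcongr
        exact hF.integral_norm_sum_range_sq_le hindep hident hX h0 m
    _ = b * ∫ ω, ‖X 0 ω‖ ^ 2 ∂ρ := by field_simp

theorem HasTypeTwoConstant.measure_le_norm_normalizedSum_le (hF : HasTypeTwoConstant F b)
    (hb : 0 ≤ b) (hindep : iIndepFun X ρ) (hident : ∀ i, IdentDistrib (X i) (X 0) ρ ρ)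
    (hX : MemLp (X 0) 2 ρ) (h0 : ∫ ω, X 0 ω ∂ρ = 0) (m : ℕ) {R : ℝ} (hR : 0 < R) :
    ρ {ω | R ≤ ‖normalizedSum X m ω‖} ≤ ENNReal.ofReal (b * (∫ ω, ‖X 0 ω‖ ^ 2 ∂ρ) / R ^ 2) := by
  refine (measure_le_norm_le_ofReal_integral_norm_sq_div
    ((memLp_finsetSum _ fun i _ => (hident i).memLp_iff.2 hX).const_smul _) hR).trans
    (ENNReal.ofReal_le_ofReal ?_)
  gcongr
  exact hF.integral_norm_normalizedSum_sq_le hb hindep hident hX h0 m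

theorem HasTypeTwoConstant.exists_isCompact_measure_normalizedSum_notMem_le
    (hF : HasTypeTwoConstant F b) (hb : 0 ≤ b) (hindep : iIndepFun X ρ)
    (hident : ∀ i, IdentDistrib (X i) (X 0) ρ ρ) (hX : MemLp (X 0) 2 ρ) (h0 : ∫ ω, X 0 ω ∂ρ = 0)
    {V : Submodule ℝ F} [FiniteDimensional ℝ V] (hV : ∀ i ω, X i ω ∈ V) {ε : ℝ} (hε : 0 < ε) :
    ∃ K : Set F, IsCompact K ∧ ∀ m, ρ {ω | normalizedSum X m ω ∉ K} ≤ ENNReal.ofReal ε := by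
  have hdecay : Tendsto (fun R : ℝ => b * (∫ ω, ‖X 0 ω‖ ^ 2 ∂ρ) / R ^ 2) atTop (𝓝 0) :=
    tendsto_const_nhds.div_atTop (tendsto_pow_atTop two_ne_zero)
  obtain ⟨R, hRε, hR⟩ := ((hdecay.eventually_le_const hε).and (eventually_gt_atTop 0)).exists
  have : ProperSpace V := FiniteDimensional.proper ℝ V
  refine ⟨Subtype.val '' Metric.closedBall (0 : V) R,
    (isCompact_closedBall _ _).image continuous_subtype_val, fun m => ?_⟩
  have hmem : ∀ ω, normalizedSum X m ω ∈ V := fun ω =>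
    V.smul_mem _ (V.sum_mem fun i _ => hV i ω)
  calc ρ {ω | normalizedSum X m ω ∉ Subtype.val '' Metric.closedBall (0 : V) R}
      ≤ ρ {ω | R ≤ ‖normalizedSum X m ω‖} := by
        refine measure_mono fun ω hω => ?_
        by_contra! hlt
        exact hω ⟨⟨_, hmem ω⟩, mem_closedBall_zero_iff.2 (not_le.1 hlt).le, rfl⟩
    _ ≤ ENNReal.ofReal ε :=
        (hF.measure_le_norm_normalizedSum_le hb hindep hident hX h0 m hR).trans
          (ENNReal.ofReal_le_ofReal hRε)

theorem HasTypeTwoConstant.exists_isCompact_measure_normalizedSum_notMem_cthickening_le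
    [CompleteSpace F] (hF : HasTypeTwoConstant F b) (hb : 0 ≤ b) (hindep : iIndepFun X ρ)
    (hident : ∀ i, IdentDistrib (X i) (X 0) ρ ρ) (hX : MemLp (X 0) 2 ρ) (h0 : ∫ ω, X 0 ω ∂ρ = 0)
    {ε : ℝ} (hε : 0 < ε) :
    ∃ K : Set F, IsCompact K ∧
      ∀ m, ρ {ω | normalizedSum X m ω ∉ Metric.cthickening ε K} ≤ ENNReal.ofReal ε := by
  obtain ⟨g, hg, hg0, hgδ⟩ := exists_simpleFunc_comp_integral_eq_zero_integral_norm_sub_sq_le hX h0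
    (δ := ε ^ 3 / (2 * (b + 1))) (by positivity)
  have hgm : Measurable g := g.measurable
  have hrm : Measurable fun x => x - g x := measurable_id.sub hgm
  have hr0 : ∫ ω, X 0 ω - g (X 0 ω) ∂ρ = 0 := by
    have hsub := integral_sub (hX.integrable one_le_two) (hg.integrable one_le_two)
    simpa [h0, hg0] using hsub
  have : FiniteDimensional ℝ (Submodule.span ℝ (Set.range g)) := .span_of_finite ℝ g.finite_range
  obtain ⟨K, hK, hKε⟩ := hF.exists_isCompact_measure_normalizedSum_notMem_le hb
    (hindep.comp (fun _ => g) fun _ => hgm) (fun i => (hident i).comp hgm) hg hg0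
    (fun i ω => Submodule.subset_span (Set.mem_range_self (X i ω))) (half_pos hε)
  have hrest (m : ℕ) := hF.measure_le_norm_normalizedSum_le hb
    (hindep.comp (fun _ x => x - g x) fun _ => hrm) (fun i => (hident i).comp hrm) (hX.sub hg)
    hr0 m hε
  have hsmall : b * (∫ ω, ‖X 0 ω - g (X 0 ω)‖ ^ 2 ∂ρ) / ε ^ 2 ≤ ε / 2 :=
    calc b * (∫ ω, ‖X 0 ω - g (X 0 ω)‖ ^ 2 ∂ρ) / ε ^ 2
        ≤ (b + 1) * (ε ^ 3 / (2 * (b + 1))) / ε ^ 2 := by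
          gcongr
          linarith
      _ = ε / 2 := by field_simp
  refine ⟨K, hK, fun m => ?_⟩
  calc ρ {ω | normalizedSum X m ω ∉ Metric.cthickening ε K}
      ≤ ρ ({ω | normalizedSum (fun i => g ∘ X i) m ω ∉ K}
          ∪ {ω | ε ≤ ‖normalizedSum (fun i => (fun x => x - g x) ∘ X i) m ω‖}) := by
        refine measure_mono fun ω hω => ?_
        by_contra! hnot
        simp only [Set.mem_union, Set.mem_ofPred_eq, not_or, not_not, not_le] at hnot
        refine hω (Metric.mem_cthickening_of_dist_le _ _ _ _ hnot.1 ?_)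
        refine le_of_eq_of_le ?_ hnot.2.le
        simp only [dist_eq_norm, normalizedSum, Function.comp_apply, Finset.sum_sub_distrib,
          smul_sub]
    _ ≤ ENNReal.ofReal (ε / 2) + ENNReal.ofReal (ε / 2) :=
        (measure_union_le _ _).trans
          (add_le_add (hKε m) ((hrest m).trans (ENNReal.ofReal_le_ofReal hsmall)))
    _ = ENNReal.ofReal ε := by rw [← ENNReal.ofReal_add (by positivity) (by positivity), add_halves]

theorem HasTypeTwoConstant.isTightMeasureSet_map_normalizedSum [CompleteSpace F]
    (hF : HasTypeTwoConstant F b) (hb : 0 ≤ b) (hindep : iIndepFun X ρ)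
    (hident : ∀ i, IdentDistrib (X i) (X 0) ρ ρ) (hX : MemLp (X 0) 2 ρ)
    (h0 : ∫ ω, X 0 ω ∂ρ = 0) :
    IsTightMeasureSet (Set.range fun m => ρ.map (normalizedSum X m)) := by
  refine isTightMeasureSet_of_forall_cthickening fun ε hε => ?_
  obtain ⟨K, hK, hKε⟩ :=
    hF.exists_isCompact_measure_normalizedSum_notMem_cthickening_le hb hindep hident hX h0 hε
  refine ⟨K, hK, ?_⟩
  rintro _ ⟨m, rfl⟩
  rw [Measure.map_apply_of_aemeasurable (aemeasurable_normalizedSum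
    (fun i => (hident i).aemeasurable_fst) m) Metric.isClosed_cthickening.measurableSet.compl]
  exact hKε m

theorem IsTypeTwo.exists_tendstoInDistribution_normalizedSum [CompleteSpace F] (hF : IsTypeTwo F)
    (hindep : iIndepFun X ρ) (hident : ∀ i, IdentDistrib (X i) (X 0) ρ ρ) (hX : MemLp (X 0) 2 ρ)
    (h0 : ∫ ω, X 0 ω ∂ρ = 0) :
    ∃ G : ProbabilityMeasure F,
      IsGaussianWith (G : Measure F) 0
        (fun f g => cov[fun ω => f (X 0 ω), fun ω => g (X 0 ω); ρ]) ∧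
      TendstoInDistribution (normalizedSum X) atTop id (fun _ => ρ) (G : Measure F) := by
  obtain ⟨b, hb, hFb : HasTypeTwoConstant F b⟩ := hF
  have hXm : ∀ i, AEMeasurable (X i) ρ := fun i => (hident i).aemeasurable_fst
  have hmeas : ∀ m, AEMeasurable (normalizedSum X m) ρ := aemeasurable_normalizedSum hXm
  obtain ⟨G, hGL, hG⟩ := exists_tendsto_of_isTightMeasureSet_of_tendsto_map (l := atTop)
    (μ := fun m => (⟨ρ.map (normalizedSum X m), Measure.isProbabilityMeasure_map (hmeas m)⟩ :
      ProbabilityMeasure F))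
    (ν := fun L => ⟨gaussianReal 0 Var[fun ω => L (X 0 ω); ρ].toNNReal, inferInstance⟩)
    (hFb.isTightMeasureSet_map_normalizedSum hb.le hindep hident hX h0) fun L => by
      have hlim := (tendstoInDistribution_dual_normalizedSum hindep hident hX h0 L).tendsto
      simp only [Measure.map_id] at hlim
      refine hlim.congr fun m => Subtype.ext ?_
      exact (AEMeasurable.map_map_of_aemeasurable L.continuous.measurable.aemeasurable
        (hmeas m)).symm
  refine ⟨G, isGaussianWith_zero_of_map_eq_gaussianReal_variance hX hGL, hmeas, aemeasurable_id, ?_⟩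
  simp only [Measure.map_id]
  exact hG

end TypeTwo

section ProductSpace

variable {E E' F : Type*} [MeasurableSpace E] [MeasurableSpace E'] [NormedAddCommGroup F]
  {P : Measure E} {Q : Measure E'} {h : E × E' → F}

theorem ae_memLp_two_section_right [SFinite P] [SFinite Q] (hh : MemLp h 2 (P.prod Q)) :
    ∀ᵐ y ∂Q, MemLp (fun x => h (x, y)) 2 P := by
  filter_upwards [hh.1.prod_swap.prodMk_left, hh.integrable_norm_pow two_ne_zero |>.prod_left_ae]
    with y hmeas hint
  exact (memLp_two_iff_integrable_sq_norm hmeas).2 hint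

variable [NormedSpace ℝ F] [IsProbabilityMeasure P] [IsProbabilityMeasure Q]

theorem setIntegral_fst_preimage (hh : Integrable h (P.prod Q)) (t : Set E) :
    ∫ z in Prod.fst ⁻¹' t, h z ∂(P.prod Q) = ∫ x in t, ∫ y, h (x, y) ∂Q ∂P := by
  rw [← Set.prod_univ, setIntegral_prod _ hh.integrableOn, Measure.restrict_univ]

theorem setIntegral_snd_preimage (hh : Integrable h (P.prod Q)) (t : Set E') :
    ∫ z in Prod.snd ⁻¹' t, h z ∂(P.prod Q) = ∫ y in t, ∫ x, h (x, y) ∂P ∂Q := by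
  rw [← Set.univ_prod, ← setIntegral_prod_swap]
  exact (setIntegral_prod _ hh.swap.integrableOn).trans (by simp)

theorem condExp_comap_fst_ae_eq [CompleteSpace F] (hh : Integrable h (P.prod Q)) :
    (P.prod Q)[h | MeasurableSpace.comap Prod.fst inferInstance]
      =ᵐ[P.prod Q] fun z => ∫ y, h (z.1, y) ∂Q := by
  have hint : Integrable (fun z : E × E' => ∫ y, h (z.1, y) ∂Q) (P.prod Q) :=
    hh.integral_prod_left.comp_fst Q
  refine (ae_eq_condExp_of_forall_setIntegral_eq measurable_fst.comap_le hh
    (fun s _ _ => hint.integrableOn) (fun s hs _ => ?_) ?_).symm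
  · obtain ⟨t, -, rfl⟩ := hs
    simp [setIntegral_fst_preimage hint, setIntegral_fst_preimage hh]
  · exact (hh.1.integral_prod_right'.mono_ac
      Measure.quasiMeasurePreserving_fst.absolutelyContinuous).comp_ae_measurable'
        measurable_fst.aemeasurable

theorem condExp_comap_snd_ae_eq [CompleteSpace F] (hh : Integrable h (P.prod Q)) :
    (P.prod Q)[h | MeasurableSpace.comap Prod.snd inferInstance]
      =ᵐ[P.prod Q] fun z => ∫ x, h (x, z.2) ∂P := by
  have hint : Integrable (fun z : E × E' => ∫ x, h (x, z.2) ∂P) (P.prod Q) :=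
    hh.integral_prod_right.comp_snd P
  refine (ae_eq_condExp_of_forall_setIntegral_eq measurable_snd.comap_le hh
    (fun s _ _ => hint.integrableOn) (fun s hs _ => ?_) ?_).symm
  · obtain ⟨t, -, rfl⟩ := hs
    simp [setIntegral_snd_preimage hint, setIntegral_snd_preimage hh]
  · exact (hh.swap.1.integral_prod_right'.mono_ac
      Measure.quasiMeasurePreserving_snd.absolutelyContinuous).comp_ae_measurable'
        measurable_snd.aemeasurable

theorem memLp_integral_prod_right [CompleteSpace F] {p : ENNReal} (hp : 1 ≤ p)
    (hh : MemLp h p (P.prod Q)) : MemLp (fun x => ∫ y, h (x, y) ∂Q) p P := by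
  have hmeas : AEStronglyMeasurable (fun x => ∫ y, h (x, y) ∂Q) P := hh.1.integral_prod_right'
  rw [← (measurePreserving_fst (μ := P) (ν := Q)).map_eq] at hmeas ⊢
  exact (memLp_map_measure_iff hmeas measurable_fst.aemeasurable).2
    ((hh.condExp hp).ae_eq (condExp_comap_fst_ae_eq (hh.integrable hp)))

end ProductSpace

section Hoeffding

variable {E E' F : Type*} [MeasurableSpace E] [MeasurableSpace E'] [NormedAddCommGroup F]
  [NormedSpace ℝ F]

/-- The centered first-order projection `x ↦ E h(x, Y) - E h(X, Y)` in the Hoeffding decomposition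
of a kernel `h`, for independent `X ∼ P` and `Y ∼ Q`. The projection in the second variable is
`hoeffdingProj Q P (h ∘ Prod.swap)`. -/
noncomputable def hoeffdingProj (P : Measure E) (Q : Measure E') (h : E × E' → F) (x : E) : F :=
  (∫ y, h (x, y) ∂Q) - ∫ z, h z ∂(P.prod Q)

/-- The degenerate part of a kernel `h`: what remains of it in the Hoeffding decomposition after
subtraction of its mean and of its two first-order projections. -/
noncomputable def hoeffdingRemainder (P : Measure E) (Q : Measure E') (h : E × E' → F)
    (z : E × E') : F :=
  h z - (∫ z, h z ∂(P.prod Q)) - hoeffdingProj P Q h z.1 - hoeffdingProj Q P (h ∘ Prod.swap) z.2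

theorem hoeffdingRemainder_swap {P : Measure E} {Q : Measure E'} [SFinite P] [SFinite Q]
    {h : E × E' → F} (z : E' × E) :
    hoeffdingRemainder Q P (h ∘ Prod.swap) z = hoeffdingRemainder P Q h z.swap := by
  have hmean : ∫ z, h z.swap ∂(Q.prod P) = ∫ z, h z ∂(P.prod Q) := integral_prod_swap h
  simp only [hoeffdingRemainder, Function.comp_def, Prod.swap_swap, Prod.fst_swap, Prod.snd_swap,
    hmean]
  abel

variable [CompleteSpace F] {P : Measure E} {Q : Measure E'} [IsProbabilityMeasure P]
  [IsProbabilityMeasure Q] {h : E × E' → F}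

theorem integral_hoeffdingProj (hh : Integrable h (P.prod Q)) :
    ∫ x, hoeffdingProj P Q h x ∂P = 0 := by
  unfold hoeffdingProj
  rw [integral_sub hh.integral_prod_left (integrable_const _), integral_const, probReal_univ,
    one_smul, integral_prod h hh, sub_self]

theorem ae_integral_hoeffdingRemainder_left (hh : Integrable h (P.prod Q)) :
    ∀ᵐ y ∂Q, ∫ x, hoeffdingRemainder P Q h (x, y) ∂P = 0 := by
  have hproj : Integrable (hoeffdingProj P Q h) P :=
    hh.integral_prod_left.sub (integrable_const _)
  filter_upwards [hh.prod_left_ae] with y hy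
  set c := ∫ z, h z ∂(P.prod Q)
  have hcenter : Integrable (fun x => h (x, y) - c) P := hy.sub (integrable_const _)
  have hleft : Integrable (fun x => h (x, y) - c - hoeffdingProj P Q h x) P := hcenter.sub hproj
  have hright : hoeffdingProj Q P (h ∘ Prod.swap) y = (∫ x, h (x, y) ∂P) - c := by
    simp [hoeffdingProj, integral_prod_swap, c]
  change ∫ x, h (x, y) - c - hoeffdingProj P Q h x - hoeffdingProj Q P (h ∘ Prod.swap) y ∂P = 0
  rw [integral_sub hleft (integrable_const _), integral_sub hcenter hproj,
    integral_hoeffdingProj hh, integral_sub hy (integrable_const _), hright]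
  simp

theorem ae_integral_hoeffdingRemainder_right (hh : Integrable h (P.prod Q)) :
    ∀ᵐ x ∂P, ∫ y, hoeffdingRemainder P Q h (x, y) ∂Q = 0 := by
  filter_upwards [ae_integral_hoeffdingRemainder_left hh.swap] with x hx
  simpa only [hoeffdingRemainder_swap, Prod.swap_prod_mk] using hx

theorem memLp_hoeffdingProj (hh : MemLp h 2 (P.prod Q)) : MemLp (hoeffdingProj P Q h) 2 P :=
  (memLp_integral_prod_right one_le_two hh).sub (memLp_const _)

theorem memLp_hoeffdingRemainder (hh : MemLp h 2 (P.prod Q)) :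
    MemLp (hoeffdingRemainder P Q h) 2 (P.prod Q) :=
  ((hh.sub (memLp_const _)).sub
    ((memLp_hoeffdingProj hh).comp_measurePreserving measurePreserving_fst)).sub
    ((memLp_hoeffdingProj
      (hh.comp_measurePreserving Measure.measurePreserving_swap)).comp_measurePreserving
        measurePreserving_snd)

end Hoeffding

section Coordinates

variable {ι E F : Type*} [MeasurableSpace E] [MeasurableSpace F] {P : Measure E}
  [IsProbabilityMeasure P] {a : E → F}

theorem iIndepFun_comp_eval_infinitePi (ha : AEMeasurable a P) :
    iIndepFun (fun i (x : ι → E) => a (x i)) (Measure.infinitePi fun _ : ι => P) :=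
  (iIndepFun_infinitePi (X := fun _ => id) fun _ => measurable_id).comp₀ (fun _ => a)
    (fun i => (measurable_pi_apply i).aemeasurable) fun i => by
      rwa [show (fun x : ι → E => id (x i)) = Function.eval i from rfl, Measure.infinitePi_map_eval]

theorem identDistrib_comp_eval_infinitePi (ha : AEMeasurable a P) (i j : ι) :
    IdentDistrib (fun x : ι → E => a (x i)) (fun x : ι → E => a (x j))
      (Measure.infinitePi fun _ => P) (Measure.infinitePi fun _ => P) := by
  have hmp := measurePreserving_eval_infinitePi fun _ : ι => P
  refine IdentDistrib.comp_of_aemeasurable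
    ⟨(measurable_pi_apply i).aemeasurable, (measurable_pi_apply j).aemeasurable,
      (hmp i).map_eq.trans (hmp j).map_eq.symm⟩ ?_
  rwa [(hmp i).map_eq]

end Coordinates

section OneSample

variable {F : Type u} [NormedAddCommGroup F] [NormedSpace ℝ F] [MeasurableSpace F] [BorelSpace F]
  [SecondCountableTopology F] {E W : Type*} [MeasurableSpace E] [MeasurableSpace W]
  {P : Measure E} [IsProbabilityMeasure P]

theorem IsTypeTwo.exists_tendstoInDistribution_normalizedSum_infinitePi [CompleteSpace F]
    (hF : IsTypeTwo F) {a : E → F} (ha : MemLp a 2 P) (h0 : ∫ x, a x ∂P = 0) :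
    ∃ G : ProbabilityMeasure F,
      IsGaussianWith (G : Measure F) 0 (fun f g => cov[fun x => f (a x), fun x => g (a x); P]) ∧
      TendstoInDistribution (normalizedSum fun i x => a (x i)) atTop id
        (fun _ => Measure.infinitePi fun _ : ℕ => P) (G : Measure F) := by
  have hmp := measurePreserving_eval_infinitePi (fun _ : ℕ => P) 0
  have hcov : ∀ f g : StrongDual ℝ F,
      cov[fun x : ℕ → E => f (a (x 0)), fun x => g (a (x 0)); Measure.infinitePi fun _ => P]
        = cov[fun x => f (a x), fun x => g (a x); P] := fun f g =>
    hmp.hasLaw.covariance_fun_comp (f.continuous.measurable.comp_aemeasurable ha.aemeasurable)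
      (g.continuous.measurable.comp_aemeasurable ha.aemeasurable)
  simp only [← hcov]
  exact hF.exists_tendstoInDistribution_normalizedSum
    (iIndepFun_comp_eval_infinitePi ha.aemeasurable)
    (fun i => identDistrib_comp_eval_infinitePi ha.aemeasurable i 0)
    (ha.comp_measurePreserving hmp)
    ((hmp.hasLaw.integral_comp ha.1).trans h0)

theorem HasTypeTwoConstant.integral_prod_norm_sum_sq_le {b : ℝ} (hF : HasTypeTwoConstant F b)
    {κ : Measure W} [IsProbabilityMeasure κ] {s : E × W → F} (hs : MemLp s 2 (P.prod κ))
    (h0 : ∀ᵐ w ∂κ, ∫ x, s (x, w) ∂P = 0) (m : ℕ) :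
    ∫ z, ‖∑ i ∈ Finset.range m, s (z.1 i, z.2)‖ ^ 2 ∂((Measure.infinitePi fun _ : ℕ => P).prod κ)
      ≤ b * (m * ∫ z, ‖s z‖ ^ 2 ∂(P.prod κ)) := by
  have hmp := measurePreserving_eval_infinitePi fun _ : ℕ => P
  have hsum : MemLp (fun z : (ℕ → E) × W => ∑ i ∈ Finset.range m, s (z.1 i, z.2)) 2
      ((Measure.infinitePi fun _ : ℕ => P).prod κ) :=
    memLp_finsetSum _ fun i _ =>
      hs.comp_measurePreserving ((hmp i).prod (MeasurePreserving.id κ))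
  have hsq := hs.integrable_norm_pow two_ne_zero
  have hsumsq := hsum.integrable_norm_pow two_ne_zero
  rw [integral_prod_symm _ hsumsq, integral_prod_symm _ hsq, ← integral_const_mul,
    ← integral_const_mul]
  refine integral_mono_ae hsumsq.integral_prod_right
    ((hsq.integral_prod_right.const_mul _).const_mul _) ?_
  filter_upwards [ae_memLp_two_section_right hs, h0] with w hw hw0
  have hnorm : ∫ x, ‖s (x 0, w)‖ ^ 2 ∂(Measure.infinitePi fun _ : ℕ => P)
      = ∫ x, ‖s (x, w)‖ ^ 2 ∂P := (hmp 0).hasLaw.integral_comp (hw.1.norm.pow 2)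
  rw [← hnorm]
  exact hF.integral_norm_sum_range_sq_le (X := fun i (x : ℕ → E) => s (x i, w))
    (iIndepFun_comp_eval_infinitePi (a := fun x => s (x, w)) hw.aemeasurable)
    (fun i => identDistrib_comp_eval_infinitePi (a := fun x => s (x, w)) hw.aemeasurable i 0)
    (hw.comp_measurePreserving (hmp 0))
    (((hmp 0).hasLaw.integral_comp hw.1).trans hw0) m

end OneSample

section TwoSample

variable {E E' : Type*} [MeasurableSpace E] [MeasurableSpace E']

/-- The joint law of two independent infinite samples, from `P` and from `Q`. -/
noncomputable def twoSampleMeasure (P : Measure E) (Q : Measure E') :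
    Measure ((ℕ → E) × (ℕ → E')) :=
  (Measure.infinitePi fun _ => P).prod (Measure.infinitePi fun _ => Q)

/-- The two-sample U-statistic with kernel `h`, based on the first `m` observations of the first
sample and the first `n` observations of the second one (it is `0` for `m = 0` or `n = 0`). -/
noncomputable def twoSampleUStat {F : Type*} [AddCommGroup F] [Module ℝ F] (h : E × E' → F)
    (m n : ℕ) (z : (ℕ → E) × (ℕ → E')) : F :=
  ((m : ℝ) * n)⁻¹ • ∑ i ∈ Finset.range m, ∑ j ∈ Finset.range n, h (z.1 i, z.2 j)

variable {P : Measure E} {Q : Measure E'} [IsProbabilityMeasure P] [IsProbabilityMeasure Q]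

instance : IsProbabilityMeasure (twoSampleMeasure P Q) := by
  unfold twoSampleMeasure
  infer_instance

theorem measurePreserving_eval_twoSampleMeasure (i j : ℕ) :
    MeasurePreserving (fun z : (ℕ → E) × (ℕ → E') => (z.1 i, z.2 j)) (twoSampleMeasure P Q)
      (P.prod Q) :=
  (measurePreserving_eval_infinitePi (fun _ => P) i).prod
    (measurePreserving_eval_infinitePi (fun _ => Q) j)

theorem memLp_twoSampleUStat {F : Type*} [NormedAddCommGroup F] [NormedSpace ℝ F]
    {h : E × E' → F} {p : ENNReal} (hh : MemLp h p (P.prod Q)) (m n : ℕ) :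
    MemLp (twoSampleUStat h m n) p (twoSampleMeasure P Q) :=
  (memLp_finsetSum _ fun i _ => memLp_finsetSum _ fun j _ =>
    hh.comp_measurePreserving (measurePreserving_eval_twoSampleMeasure i j)).const_smul _

theorem ae_integral_sum_range_eq_zero {F : Type*} [NormedAddCommGroup F] [NormedSpace ℝ F]
    {r : E × E' → F} (hr : Integrable r (P.prod Q)) (hleft : ∀ᵐ y ∂Q, ∫ x, r (x, y) ∂P = 0)
    (n : ℕ) :
    ∀ᵐ y ∂(Measure.infinitePi fun _ : ℕ => Q),
      ∫ x, ∑ j ∈ Finset.range n, r (x, y j) ∂P = 0 := by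
  have heval := fun j =>
    (measurePreserving_eval_infinitePi (fun _ : ℕ => Q) j).quasiMeasurePreserving
  filter_upwards [ae_all_iff.2 fun j => (heval j).ae hr.prod_left_ae,
    ae_all_iff.2 fun j => (heval j).ae hleft] with y hint hzero
  rw [integral_finsetSum _ fun j _ => hint j]
  exact Finset.sum_eq_zero fun j _ => hzero j

variable {F : Type u} [NormedAddCommGroup F] [NormedSpace ℝ F] [MeasurableSpace F] [BorelSpace F]
  [SecondCountableTopology F] {b : ℝ} {r : E × E' → F}

theorem HasTypeTwoConstant.integral_norm_sum_sum_sq_le (hF : HasTypeTwoConstant F b) (hb : 0 ≤ b)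
    (hr : MemLp r 2 (P.prod Q)) (hleft : ∀ᵐ y ∂Q, ∫ x, r (x, y) ∂P = 0)
    (hright : ∀ᵐ x ∂P, ∫ y, r (x, y) ∂Q = 0) (m n : ℕ) :
    ∫ z, ‖∑ i ∈ Finset.range m, ∑ j ∈ Finset.range n, r (z.1 i, z.2 j)‖ ^ 2 ∂twoSampleMeasure P Q
      ≤ b ^ 2 * (m * n * ∫ z, ‖r z‖ ^ 2 ∂(P.prod Q)) := by
  have hsum : MemLp (fun z : E × (ℕ → E') => ∑ j ∈ Finset.range n, r (z.1, z.2 j)) 2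
      (P.prod (Measure.infinitePi fun _ : ℕ => Q)) :=
    memLp_finsetSum _ fun j _ => hr.comp_measurePreserving
      ((MeasurePreserving.id P).prod (measurePreserving_eval_infinitePi (fun _ : ℕ => Q) j))
  have hinner := hF.integral_prod_norm_sum_sq_le
    (hr.comp_measurePreserving Measure.measurePreserving_swap) hright n
  have houter := hF.integral_prod_norm_sum_sq_le hsum
    (ae_integral_sum_range_eq_zero (hr.integrable one_le_two) hleft n) m
  calc _ ≤ b * (m * ∫ z, ‖∑ j ∈ Finset.range n, r (z.1, z.2 j)‖ ^ 2
            ∂(P.prod (Measure.infinitePi fun _ : ℕ => Q))) := houter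
    _ = b * (m * ∫ z, ‖∑ j ∈ Finset.range n, r (z.2, z.1 j)‖ ^ 2
            ∂((Measure.infinitePi fun _ : ℕ => Q).prod P)) := by
        rw [← integral_prod_swap]
        rfl
    _ ≤ b * (m * (b * (n * ∫ z, ‖r z.swap‖ ^ 2 ∂(Q.prod P)))) := by
        gcongr
        exact hinner
    _ = b ^ 2 * (m * n * ∫ z, ‖r z‖ ^ 2 ∂(P.prod Q)) := by
        rw [integral_prod_swap fun z => ‖r z‖ ^ 2]
        ring

theorem HasTypeTwoConstant.integral_norm_twoSampleUStat_sq_le (hF : HasTypeTwoConstant F b)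
    (hb : 0 ≤ b) (hr : MemLp r 2 (P.prod Q)) (hleft : ∀ᵐ y ∂Q, ∫ x, r (x, y) ∂P = 0)
    (hright : ∀ᵐ x ∂P, ∫ y, r (x, y) ∂Q = 0) {m n : ℕ} (hm : m ≠ 0) (hn : n ≠ 0) :
    ∫ z, ‖twoSampleUStat r m n z‖ ^ 2 ∂twoSampleMeasure P Q
      ≤ b ^ 2 / (m * n) * ∫ z, ‖r z‖ ^ 2 ∂(P.prod Q) := by
  simp only [twoSampleUStat, norm_smul, mul_pow, Real.norm_eq_abs, sq_abs]
  rw [integral_const_mul]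
  calc _ ≤ ((m : ℝ) * n)⁻¹ ^ 2 * (b ^ 2 * (m * n * ∫ z, ‖r z‖ ^ 2 ∂(P.prod Q))) := by
        gcongr
        exact hF.integral_norm_sum_sum_sq_le hb hr hleft hright m n
    _ = b ^ 2 / (m * n) * ∫ z, ‖r z‖ ^ 2 ∂(P.prod Q) := by field_simp

end TwoSample

section Slutsky

theorem tendstoInMeasure_const_of_tendsto {ι Ω F : Type*} [PseudoMetricSpace F] [MeasurableSpace Ω]
    {μ : Measure Ω} {l : Filter ι} {a : ι → F} {a₀ : F}
    (ha : Tendsto a l (𝓝 a₀)) : TendstoInMeasure μ (fun k _ => a k) l fun _ => a₀ := by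
  rw [tendstoInMeasure_iff_dist]
  intro ε hε
  refine tendsto_const_nhds.congr' ?_
  filter_upwards [ha (Metric.ball_mem_nhds a₀ hε)] with k hk
  simp [not_le.2 (Metric.mem_ball.1 hk)]

variable {ι Ω₁ Ω₂ : Type*} [MeasurableSpace Ω₁] [MeasurableSpace Ω₂] {l : Filter ι}
  {μ : Measure Ω₁} {ν : Measure Ω₂} [IsProbabilityMeasure μ] [IsProbabilityMeasure ν]

theorem map_prodMap_of_aemeasurable {F F' : Type*} [MeasurableSpace F] [MeasurableSpace F']
    {X : Ω₁ → F} {Y : Ω₂ → F'} (hX : AEMeasurable X μ) (hY : AEMeasurable Y ν) :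
    (μ.prod ν).map (fun z => (X z.1, Y z.2)) = (μ.map X).prod (ν.map Y) := by
  have hfst := HasLaw.fun_comp ⟨hX, rfl⟩ (measurePreserving_fst (μ := μ) (ν := ν)).hasLaw
  have hsnd := HasLaw.fun_comp ⟨hY, rfl⟩ (measurePreserving_snd (μ := μ) (ν := ν)).hasLaw
  exact ((indepFun_iff_hasLaw_prodMk_prod hfst hsnd).1 (indepFun_prod₀ hX hY)).map_eq

theorem tendstoInDistribution_id_map {F F' : Type*} [TopologicalSpace F] [MeasurableSpace F]
    [OpensMeasurableSpace F] [MeasurableSpace F'] {X : ι → Ω₁ → F} {Z : F' → F}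
    {G : ProbabilityMeasure F'}
    (hX : TendstoInDistribution X l Z (fun _ => μ) (G : Measure F')) :
    TendstoInDistribution X l id (fun _ => μ)
      (G.map hX.aemeasurable_limit : Measure F) := by
  refine ⟨hX.forall_aemeasurable, aemeasurable_id, ?_⟩
  simp only [Measure.map_id]
  exact hX.tendsto

theorem tendstoInDistribution_prodMap {F F' : Type*} [TopologicalSpace F] [TopologicalSpace F']
    [SecondCountableTopology F] [SecondCountableTopology F']
    [TopologicalSpace.PseudoMetrizableSpace F] [TopologicalSpace.PseudoMetrizableSpace F']
    [MeasurableSpace F] [MeasurableSpace F'] [BorelSpace F] [BorelSpace F']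
    {X : ι → Ω₁ → F} {Y : ι → Ω₂ → F'} {G : ProbabilityMeasure F} {G' : ProbabilityMeasure F'}
    (hX : TendstoInDistribution X l id (fun _ => μ) (G : Measure F))
    (hY : TendstoInDistribution Y l id (fun _ => ν) (G' : Measure F')) :
    TendstoInDistribution (fun k z => (X k z.1, Y k z.2)) l id (fun _ => μ.prod ν)
      (G.prod G' : Measure (F × F')) := by
  have hXm := hX.forall_aemeasurable
  have hYm := hY.forall_aemeasurable
  have hXlim := hX.tendsto
  have hYlim := hY.tendsto
  refine ⟨fun k => (hXm k).comp_fst.prodMk (hYm k).comp_snd, by fun_prop, ?_⟩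
  simp only [Measure.map_id] at hXlim hYlim ⊢
  refine ((ProbabilityMeasure.continuous_prod.tendsto (G, G')).comp
    (hXlim.prodMk_nhds hYlim)).congr fun k => Subtype.ext ?_
  exact (map_prodMap_of_aemeasurable (hXm k) (hYm k)).symm

theorem tendstoInDistribution_comp_tendsto {F : Type*} [TopologicalSpace F] [MeasurableSpace F]
    [OpensMeasurableSpace F] {κ : Type*} {l' : Filter κ} {X : κ → Ω₁ → F}
    {G : ProbabilityMeasure F} (hX : TendstoInDistribution X l' id (fun _ => μ) (G : Measure F))
    {m : ι → κ} (hm : Tendsto m l l') :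
    TendstoInDistribution (fun k => X (m k)) l id (fun _ => μ) (G : Measure F) :=
  ⟨fun k => hX.forall_aemeasurable (m k), aemeasurable_id, hX.tendsto.comp hm⟩

theorem tendstoInDistribution_smul_add_smul_prod {F : Type*} [NormedAddCommGroup F]
    [NormedSpace ℝ F] [SecondCountableTopology F] [MeasurableSpace F] [BorelSpace F]
    [l.IsCountablyGenerated] {X : ι → Ω₁ → F} {Y : ι → Ω₂ → F} {G G' : ProbabilityMeasure F}
    (hX : TendstoInDistribution X l id (fun _ => μ) (G : Measure F))
    (hY : TendstoInDistribution Y l id (fun _ => ν) (G' : Measure F))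
    {s t : ι → ℝ} {s₀ t₀ : ℝ} (hs : Tendsto s l (𝓝 s₀)) (ht : Tendsto t l (𝓝 t₀)) :
    TendstoInDistribution (fun k z => s k • X k z.1 + t k • Y k z.2) l
      (fun p : F × F => s₀ • p.1 + t₀ • p.2) (fun _ => μ.prod ν)
      (G.prod G' : Measure (F × F)) :=
  (tendstoInDistribution_prodMap hX hY).continuous_comp_prodMk_of_tendstoInMeasure_const
    (g := fun p : (F × F) × (ℝ × ℝ) => p.2.1 • p.1.1 + p.2.2 • p.1.2) (by fun_prop)
    (Y := fun k _ => (s k, t k)) (c := (s₀, t₀))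
    (tendstoInMeasure_const_of_tendsto (hs.prodMk_nhds ht)) fun _ => aemeasurable_const

end Slutsky

section HajekProjection

theorem sqrt_mul_div_add_mul_inv {m : ℝ} (hm : 0 < m) (n : ℝ) :
    √(m * n / (m + n)) * m⁻¹ = √(n / (m + n)) * (√m)⁻¹ := by
  have hsq : √m ^ 2 = m := Real.sq_sqrt hm.le
  have : 0 < √m := Real.sqrt_pos.2 hm
  rw [mul_div_assoc, Real.sqrt_mul hm.le]
  field_simp
  rw [hsq]

variable {E E' F : Type*} [MeasurableSpace E] [MeasurableSpace E'] [NormedAddCommGroup F]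
  [NormedSpace ℝ F]

/-- The normalized Hájek projection of the two-sample U-statistic with kernel `h`: the sum of the
two first-order terms in the Hoeffding decomposition of
`√(m n / (m + n)) • (twoSampleUStat h m n - E h(X, Y))`. -/
noncomputable def hajekProjection (P : Measure E) (Q : Measure E') (h : E × E' → F) (m n : ℕ)
    (z : (ℕ → E) × (ℕ → E')) : F :=
  √((n : ℝ) / (m + n)) • normalizedSum (fun i x => hoeffdingProj P Q h (x i)) m z.1
    + √((m : ℝ) / (m + n)) •
      normalizedSum (fun j y => hoeffdingProj Q P (h ∘ Prod.swap) (y j)) n z.2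

variable {P : Measure E} {Q : Measure E'} {m n : ℕ}

theorem twoSampleUStat_sub_integral (hm : m ≠ 0) (hn : n ≠ 0) (h : E × E' → F)
    (z : (ℕ → E) × (ℕ → E')) :
    twoSampleUStat h m n z - ∫ z, h z ∂(P.prod Q)
      = (m : ℝ)⁻¹ • ∑ i ∈ Finset.range m, hoeffdingProj P Q h (z.1 i)
        + (n : ℝ)⁻¹ • ∑ j ∈ Finset.range n, hoeffdingProj Q P (h ∘ Prod.swap) (z.2 j)
        + twoSampleUStat (hoeffdingRemainder P Q h) m n z := by
  simp only [twoSampleUStat, hoeffdingRemainder, Finset.sum_sub_distrib, Finset.sum_const,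
    Finset.card_range, ← Finset.smul_sum, ← Nat.cast_smul_eq_nsmul ℝ]
  match_scalars <;> field_simp <;> ring

theorem sqrt_smul_twoSampleUStat_sub_hajekProjection (hm : m ≠ 0) (hn : n ≠ 0) (h : E × E' → F)
    (z : (ℕ → E) × (ℕ → E')) :
    √((m : ℝ) * n / (m + n)) • (twoSampleUStat h m n z - ∫ z, h z ∂(P.prod Q))
        - hajekProjection P Q h m n z
      = √((m : ℝ) * n / (m + n)) • twoSampleUStat (hoeffdingRemainder P Q h) m n z := by
  have hm0 : (0 : ℝ) < m := by positivity
  have hn0 : (0 : ℝ) < n := by positivity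
  have hcoefm := sqrt_mul_div_add_mul_inv hm0 n
  have hcoefn := sqrt_mul_div_add_mul_inv hn0 m
  rw [mul_comm (n : ℝ), add_comm (n : ℝ)] at hcoefn
  rw [twoSampleUStat_sub_integral hm hn, hajekProjection, normalizedSum, normalizedSum, smul_smul,
    smul_smul, ← hcoefm, ← hcoefn]
  module

end HajekProjection

section TwoSampleCLT

variable {ι : Type*} {l : Filter ι} {m n : ι → ℕ} {γ : ℝ}

theorem mem_Icc_of_tendsto_div_add [l.NeBot]
    (hmn : Tendsto (fun k => (m k : ℝ) / ((m k : ℝ) + (n k : ℝ))) l (𝓝 γ)) :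
    γ ∈ Set.Icc (0 : ℝ) 1 :=
  isClosed_Icc.mem_of_tendsto hmn <| Eventually.of_forall fun k =>
    ⟨by positivity, div_le_one_of_le₀ (by simp) (by positivity)⟩

theorem tendsto_div_add_one_sub (hm : Tendsto m l atTop)
    (hmn : Tendsto (fun k => (m k : ℝ) / ((m k : ℝ) + (n k : ℝ))) l (𝓝 γ)) :
    Tendsto (fun k => (n k : ℝ) / ((m k : ℝ) + (n k : ℝ))) l (𝓝 (1 - γ)) := by
  refine (hmn.const_sub 1).congr' ?_
  filter_upwards [hm.eventually_gt_atTop 0] with k hk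
  have : (0 : ℝ) < m k := by exact_mod_cast hk
  field_simp
  ring

variable {E E' : Type*} [MeasurableSpace E] [MeasurableSpace E'] {P : Measure E} {Q : Measure E'}
  [IsProbabilityMeasure P] [IsProbabilityMeasure Q] {F : Type u} [NormedAddCommGroup F]
  [NormedSpace ℝ F]

theorem covariance_dual_hoeffdingProj {h : E × E' → F}
    (hh : Integrable h (P.prod Q)) (f g : StrongDual ℝ F) :
    cov[fun x => f (hoeffdingProj P Q h x), fun x => g (hoeffdingProj P Q h x); P]
      = cov[fun x => f (∫ y, h (x, y) ∂Q), fun x => g (∫ y, h (x, y) ∂Q); P] := by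
  have hint : ∀ L : StrongDual ℝ F, Integrable (fun x => L (∫ y, h (x, y) ∂Q)) P := fun L =>
    L.integrable_comp hh.integral_prod_left
  simp only [hoeffdingProj, map_sub]
  rw [covariance_sub_const_left (hint f), covariance_sub_const_right (hint g)]

variable [MeasurableSpace F] [BorelSpace F] [SecondCountableTopology F]

theorem HasTypeTwoConstant.tendstoInMeasure_sqrt_smul_twoSampleUStat {b : ℝ}
    (hF : HasTypeTwoConstant F b) (hb : 0 ≤ b) {r : E × E' → F} (hr : MemLp r 2 (P.prod Q))
    (hleft : ∀ᵐ y ∂Q, ∫ x, r (x, y) ∂P = 0) (hright : ∀ᵐ x ∂P, ∫ y, r (x, y) ∂Q = 0)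
    (hm : Tendsto m l atTop) (hn : ∀ᶠ k in l, n k ≠ 0) :
    TendstoInMeasure (twoSampleMeasure P Q) (fun k z =>
      √((m k : ℝ) * n k / (m k + n k)) • twoSampleUStat r (m k) (n k) z) l 0 := by
  rw [tendstoInMeasure_iff_norm]
  intro ε hε
  set I := ∫ z, ‖r z‖ ^ 2 ∂(P.prod Q)
  have : 0 ≤ I := by positivity
  have hzero : Tendsto (fun k => ENNReal.ofReal (b ^ 2 * I / m k / ε ^ 2)) l (𝓝 0) := by
    have hdiv := ((tendsto_natCast_atTop_atTop (R := ℝ)).comp hm).const_div_atTop (b ^ 2 * I)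
    simpa using ENNReal.tendsto_ofReal (hdiv.div_const (ε ^ 2))
  refine tendsto_of_tendsto_of_tendsto_of_le_of_le' tendsto_const_nhds hzero
    (Eventually.of_forall fun _ => zero_le) ?_
  filter_upwards [hm.eventually_ne_atTop 0, hn] with k hmk hnk
  simp only [Pi.zero_apply, sub_zero]
  refine (measure_le_norm_le_ofReal_integral_norm_sq_div
    ((memLp_twoSampleUStat hr _ _).const_smul _) hε).trans (ENNReal.ofReal_le_ofReal ?_)
  gcongr
  simp only [Pi.smul_apply, norm_smul, mul_pow, Real.norm_eq_abs, sq_abs]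
  rw [integral_const_mul, Real.sq_sqrt (by positivity)]
  calc _ ≤ (m k : ℝ) * n k / (m k + n k) * (b ^ 2 / (m k * n k) * I) := by
        gcongr
        exact hF.integral_norm_twoSampleUStat_sq_le hb hr hleft hright hmk hnk
    _ = b ^ 2 * I / (m k + n k) := by field_simp
    _ ≤ b ^ 2 * I / m k := by
        have : (0 : ℝ) < m k := by positivity
        gcongr
        simp

variable [CompleteSpace F]

theorem IsTypeTwo.exists_tendstoInDistribution_hajekProjection (hF : IsTypeTwo F) [l.NeBot]
    [l.IsCountablyGenerated] {h : E × E' → F} (hh : MemLp h 2 (P.prod Q))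
    (hm : Tendsto m l atTop) (hn : Tendsto n l atTop)
    (hmn : Tendsto (fun k => (m k : ℝ) / ((m k : ℝ) + (n k : ℝ))) l (𝓝 γ)) :
    ∃ G : ProbabilityMeasure F,
      IsGaussianWith (G : Measure F) 0 (fun f g =>
        (1 - γ) * cov[fun x => f (∫ y, h (x, y) ∂Q), fun x => g (∫ y, h (x, y) ∂Q); P]
        + γ * cov[fun y => f (∫ x, h (x, y) ∂P), fun y => g (∫ x, h (x, y) ∂P); Q]) ∧
      TendstoInDistribution (fun k => hajekProjection P Q h (m k) (n k)) l id
        (fun _ => twoSampleMeasure P Q) (G : Measure F) := by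
  have hh' : MemLp (h ∘ Prod.swap) 2 (Q.prod P) :=
    hh.comp_measurePreserving Measure.measurePreserving_swap
  have hint := hh.integrable one_le_two
  have hint' := hh'.integrable one_le_two
  obtain ⟨hγ0, hγ1⟩ := mem_Icc_of_tendsto_div_add hmn
  obtain ⟨G₁, hG₁, hlim₁⟩ := hF.exists_tendstoInDistribution_normalizedSum_infinitePi
    (memLp_hoeffdingProj hh) (integral_hoeffdingProj hint)
  obtain ⟨G₂, hG₂, hlim₂⟩ := hF.exists_tendstoInDistribution_normalizedSum_infinitePi
    (memLp_hoeffdingProj hh') (integral_hoeffdingProj hint')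
  have hlim := tendstoInDistribution_smul_add_smul_prod
    (tendstoInDistribution_comp_tendsto hlim₁ hm) (tendstoInDistribution_comp_tendsto hlim₂ hn)
    (tendsto_div_add_one_sub hm hmn).sqrt hmn.sqrt
  refine ⟨_, ?_, tendstoInDistribution_id_map hlim⟩
  have hG := hG₁.map_smul_add_smul hG₂ √(1 - γ) √γ
  simp only [smul_zero, add_zero, Real.sq_sqrt hγ0, Real.sq_sqrt (sub_nonneg.2 hγ1),
    covariance_dual_hoeffdingProj hint, covariance_dual_hoeffdingProj hint'] at hG
  exact hG

theorem IsTypeTwo.exists_tendstoInDistribution_twoSampleUStat (hF : IsTypeTwo F) [l.NeBot]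
    [l.IsCountablyGenerated] {h : E × E' → F} (hh : MemLp h 2 (P.prod Q))
    (hm : Tendsto m l atTop) (hn : Tendsto n l atTop)
    (hmn : Tendsto (fun k => (m k : ℝ) / ((m k : ℝ) + (n k : ℝ))) l (𝓝 γ)) :
    ∃ G : ProbabilityMeasure F,
      IsGaussianWith (G : Measure F) 0 (fun f g =>
        (1 - γ) * cov[fun x => f (∫ y, h (x, y) ∂Q), fun x => g (∫ y, h (x, y) ∂Q); P]
        + γ * cov[fun y => f (∫ x, h (x, y) ∂P), fun y => g (∫ x, h (x, y) ∂P); Q]) ∧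
      TendstoInDistribution (fun k z => √((m k : ℝ) * n k / (m k + n k)) •
          (twoSampleUStat h (m k) (n k) z - ∫ z, h z ∂(P.prod Q))) l id
        (fun _ => twoSampleMeasure P Q) (G : Measure F) := by
  obtain ⟨G, hG, hlim⟩ := hF.exists_tendstoInDistribution_hajekProjection hh hm hn hmn
  obtain ⟨b, hb, hFb : HasTypeTwoConstant F b⟩ := hF
  have hint := hh.integrable one_le_two
  have hrem := hFb.tendstoInMeasure_sqrt_smul_twoSampleUStat (l := l) hb.le
    (memLp_hoeffdingRemainder hh) (ae_integral_hoeffdingRemainder_left hint)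
    (ae_integral_hoeffdingRemainder_right hint) hm (hn.eventually_ne_atTop 0)
  refine ⟨G, hG, tendstoInDistribution_of_tendstoInMeasure_sub _ _ hlim
    (hrem.congr' ?_ EventuallyEq.rfl) fun k => (((memLp_twoSampleUStat hh _ _).sub
      (memLp_const _)).const_smul _).aemeasurable⟩
  filter_upwards [hm.eventually_ne_atTop 0, hn.eventually_ne_atTop 0] with k hmk hnk
  exact ae_of_all _ fun z => (sqrt_smul_twoSampleUStat_sub_hajekProjection hmk hnk h z).symm

end TwoSampleCLT

section SeparableDual

variable {E : Type*} [NormedAddCommGroup E] [NormedSpace ℝ E]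

theorem dense_span_of_forall_dual_eq_zero {s : Set E}
    (hs : ∀ g : StrongDual ℝ E, (∀ x ∈ s, g x = 0) → g = 0) :
    Dense (Submodule.span ℝ s : Set E) := by
  set V := (Submodule.span ℝ s).topologicalClosure
  have hclosed : IsClosed (V : Set E) := Submodule.isClosed_topologicalClosure _
  intro y
  by_contra hy
  have hy0 : V.mkQL y ≠ 0 := (Submodule.Quotient.mk_eq_zero V).not.2 hy
  obtain ⟨f, hf⟩ := SeparatingDual.exists_ne_zero (R := ℝ) hy0
  have hg : f.comp V.mkQL = 0 := hs _ fun x hx => by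
    have hx0 : V.mkQL x = 0 := (Submodule.Quotient.mk_eq_zero V).2
      (Submodule.le_topologicalClosure _ (Submodule.subset_span hx))
    simp [hx0]
  exact hf (by simpa using DFunLike.congr_fun hg y)

theorem exists_norm_le_one_half_norm_le_norm_apply (f : StrongDual ℝ E) :
    ∃ x : E, ‖x‖ ≤ 1 ∧ ‖f‖ / 2 ≤ ‖f x‖ := by
  rcases (norm_nonneg f).eq_or_lt with h0 | h0
  · exact ⟨0, by simp, by simp [← h0]⟩
  · obtain ⟨x, hx, hfx⟩ := f.exists_lt_apply_of_lt_opNorm (half_lt_self h0)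
    exact ⟨x, hx.le, hfx.le⟩

theorem separableSpace_of_separableSpace_strongDual (E : Type*) [NormedAddCommGroup E]
    [NormedSpace ℝ E] [TopologicalSpace.SeparableSpace (StrongDual ℝ E)] :
    TopologicalSpace.SeparableSpace E := by
  obtain ⟨e, he⟩ := TopologicalSpace.exists_dense_seq (StrongDual ℝ E)
  choose x hx hex using fun n => exists_norm_le_one_half_norm_le_norm_apply (e n)
  have hdense : Dense (Submodule.span ℝ (Set.range x) : Set E) := by
    refine dense_span_of_forall_dual_eq_zero fun g hg => ?_
    by_contra hne
    have hpos : 0 < ‖g‖ := norm_pos_iff.2 hne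
    obtain ⟨n, hn⟩ := he.exists_dist_lt g (show 0 < ‖g‖ / 4 by positivity)
    rw [dist_eq_norm] at hn
    have happly : ‖e n (x n)‖ ≤ ‖g - e n‖ := by
      simpa [hg (x n) (Set.mem_range_self n)] using (g - e n).unit_le_opNorm _ (hx n)
    linarith [hex n, norm_sub_norm_le g (e n)]
  rw [← TopologicalSpace.isSeparable_univ_iff, ← hdense.closure_eq]
  exact (Set.countable_range x).isSeparable.span.closure

theorem measurable_of_measurableSet_preimage_closedBall {Ω F : Type*} [MeasurableSpace Ω]
    [PseudoMetricSpace F] [TopologicalSpace.SeparableSpace F] [MeasurableSpace F] [BorelSpace F]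
    {φ : Ω → F} (hφ : ∀ x r, MeasurableSet (φ ⁻¹' Metric.closedBall x r)) : Measurable φ := by
  refine measurable_of_isOpen fun s hs => ?_
  rcases isEmpty_or_nonempty F with _ | _
  · simp [Set.eq_empty_of_isEmpty s]
  obtain ⟨e, he⟩ := TopologicalSpace.exists_dense_seq F
  have hcover : s = ⋃ p : {p : ℕ × ℚ // Metric.closedBall (e p.1) p.2 ⊆ s},
      Metric.closedBall (e p.1.1) p.1.2 := by
    refine Set.Subset.antisymm (fun x hx => ?_) (Set.iUnion_subset fun p => p.2)
    obtain ⟨ε, hε, hεs⟩ := Metric.isOpen_iff.1 hs x hx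
    obtain ⟨q, hq0, hq⟩ := exists_rat_btwn (half_pos hε)
    obtain ⟨n, hn⟩ := he.exists_dist_lt x hq0
    refine Set.mem_iUnion.2 ⟨⟨(n, q), fun y hy => hεs ?_⟩, hn.le⟩
    rw [Metric.mem_closedBall] at hy
    rw [Metric.mem_ball]
    linarith [dist_triangle_right y x (e n)]
  rw [hcover, Set.preimage_iUnion]
  exact MeasurableSet.iUnion fun p => hφ _ _

theorem measurable_strongDual_of_forall_apply [TopologicalSpace.SeparableSpace (StrongDual ℝ E)]
    {Ω : Type*} [MeasurableSpace Ω] {φ : Ω → StrongDual ℝ E}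
    (hφ : ∀ v : E, Measurable fun ω => φ ω v) : Measurable φ := by
  have := separableSpace_of_separableSpace_strongDual E
  obtain ⟨d, hd⟩ := TopologicalSpace.exists_dense_seq E
  refine measurable_of_measurableSet_preimage_closedBall fun L r => ?_
  rcases lt_or_ge r 0 with hr | hr
  · simp [Metric.closedBall_eq_empty.2 hr]
  have hpreimage : φ ⁻¹' Metric.closedBall L r
      = ⋂ n, {ω | ‖φ ω (d n) - L (d n)‖ ≤ r * ‖d n‖} := by
    ext ω
    simp only [Set.mem_preimage, Metric.mem_closedBall, dist_eq_norm, Set.mem_iInter,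
      Set.mem_ofPred_eq]
    refine ⟨fun h n => (φ ω - L).le_of_opNorm_le h (d n), fun h => ?_⟩
    refine ContinuousLinearMap.opNorm_le_bound _ hr fun x => ?_
    exact hd.induction_on (p := fun x => ‖(φ ω - L) x‖ ≤ r * ‖x‖) x
      (isClosed_le (by fun_prop) (by fun_prop)) h
  rw [hpreimage]
  exact MeasurableSet.iInter fun n =>
    measurableSet_le ((hφ _).sub_const _).norm measurable_const

end SeparableDual

section SpatialSign

variable {E : Type u} [NormedAddCommGroup E] [NormedSpace ℝ E]

theorem SGN_zero : SGN (0 : E) = 0 := by simp [SGN]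

theorem norm_SGN_le_one (x : E) : ‖SGN x‖ ≤ 1 := by
  rw [SGN]
  split_ifs with h
  · refine ContinuousLinearMap.opNorm_le_bound _ zero_le_one fun v => ?_
    simpa using (h.2.choose_spec v).le_of_lipschitz lipschitzWith_one_norm
  · simp

theorem IsSmoothSpace.isGateauxDerivNorm_SGN (hE : IsSmoothSpace E) {x : E} (hx : x ≠ 0) :
    IsGateauxDerivNorm (SGN x) x := by
  have h : x ≠ 0 ∧ ∃ L : StrongDual ℝ E, IsGateauxDerivNorm L x := ⟨hx, hE x hx⟩
  rw [SGN, dif_pos h]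
  exact h.2.choose_spec

variable [MeasurableSpace E] [BorelSpace E] [TopologicalSpace.SeparableSpace (StrongDual ℝ E)]

theorem IsSmoothSpace.measurable_SGN (hE : IsSmoothSpace E) :
    Measurable (SGN : E → StrongDual ℝ E) := by
  refine measurable_strongDual_of_forall_apply fun v => ?_
  let slope (k : ℕ) (x : E) : ℝ := (k + 1 : ℝ) * (‖x + (1 / (k + 1 : ℝ)) • v‖ - ‖x‖)
  have hslope (k : ℕ) : Measurable (({0}ᶜ : Set E).indicator (slope k)) :=
    Measurable.indicator (Continuous.measurable (by fun_prop)) (measurableSet_singleton 0).compl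
  refine measurable_of_tendsto_metrizable hslope (tendsto_pi_nhds.2 fun x => ?_)
  rcases eq_or_ne x 0 with rfl | hx
  · simp [SGN_zero]
  · have hseq : Tendsto (fun k : ℕ => 1 / ((k : ℝ) + 1)) atTop (𝓝[≠] 0) :=
      tendsto_nhdsWithin_iff.2 ⟨tendsto_one_div_add_atTop_nhds_zero_nat,
        Eventually.of_forall fun k => one_div_ne_zero k.cast_add_one_ne_zero⟩
    refine ((hE.isGateauxDerivNorm_SGN hx v).tendsto_slope_zero.comp hseq).congr fun k => ?_
    simp [slope, hx]

theorem IsSmoothSpace.memLp_SGN_sub (hE : IsSmoothSpace E) (p : ENNReal) (μ : Measure (E × E))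
    [IsFiniteMeasure μ] : MemLp (fun z : E × E => SGN (z.2 - z.1)) p μ := by
  have := separableSpace_of_separableSpace_strongDual E
  have := UniformSpace.secondCountable_of_separable E
  have := UniformSpace.secondCountable_of_separable (StrongDual ℝ E)
  exact MemLp.of_bound
    (hE.measurable_SGN.comp (measurable_snd.sub measurable_fst)).aestronglyMeasurable 1
    (ae_of_all _ fun z => norm_SGN_le_one _)

end SpatialSign

section Covariance

theorem covariance_dual_of_condExp_ae_eq {Ω F : Type*} {m mΩ : MeasurableSpace Ω} {μ : Measure Ω}
    [IsProbabilityMeasure μ] [NormedAddCommGroup F] [NormedSpace ℝ F] [CompleteSpace F]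
    (hm : m ≤ mΩ) {X V : Ω → F} (hX : MemLp X 2 μ) (hV : μ[X | m] =ᵐ[μ] V) (f g : StrongDual ℝ F) :
    cov[fun ω => f (V ω), fun ω => g (V ω); μ]
      = ∫ ω, f (μ[X | m] ω) * g (μ[X | m] ω) ∂μ - f (∫ ω, X ω ∂μ) * g (∫ ω, X ω ∂μ) := by
  have hmem : MemLp V 2 μ := (hX.condExp one_le_two).ae_eq hV
  have hmean (L : StrongDual ℝ F) : ∫ ω, L (V ω) ∂μ = L (∫ ω, X ω ∂μ) := by
    rw [L.integral_comp_comm (hmem.integrable one_le_two), ← integral_congr_ae hV,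
      integral_condExp hm]
  have hprod : ∫ ω, f (μ[X | m] ω) * g (μ[X | m] ω) ∂μ = ∫ ω, f (V ω) * g (V ω) ∂μ :=
    integral_congr_ae ((hV.fun_comp f).mul (hV.fun_comp g))
  rw [hprod, ← hmean f, ← hmean g]
  exact covariance_eq_sub (f.comp_memLp' hmem) (g.comp_memLp' hmem)

variable {E : Type u} [NormedAddCommGroup E] [NormedSpace ℝ E] [MeasurableSpace E] [BorelSpace E]
  [TopologicalSpace.SeparableSpace (StrongDual ℝ E)] (P Q : Measure E) [IsProbabilityMeasure P]
  [IsProbabilityMeasure Q] (f g : StrongDual ℝ (StrongDual ℝ E))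

theorem IsSmoothSpace.Gamma₁_eq_covariance (hE : IsSmoothSpace E) :
    Gamma₁ P Q f g
      = cov[fun x => f (∫ y, SGN (y - x) ∂Q), fun x => g (∫ y, SGN (y - x) ∂Q); P] := by
  have hmem := hE.memLp_SGN_sub 2 (P.prod Q)
  have hproj := memLp_integral_prod_right one_le_two hmem
  have hcond := condExp_comap_fst_ae_eq (hmem.integrable one_le_two)
  have hlaw := (measurePreserving_fst (μ := P) (ν := Q)).hasLaw
  have hmeas := fun L : StrongDual ℝ (StrongDual ℝ E) => (L.comp_memLp' hproj).aemeasurable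
  exact (covariance_dual_of_condExp_ae_eq measurable_fst.comap_le hmem hcond f g).symm.trans
    (hlaw.covariance_fun_comp (hmeas f) (hmeas g))

theorem IsSmoothSpace.Gamma₂_eq_covariance (hE : IsSmoothSpace E) :
    Gamma₂ P Q f g
      = cov[fun y => f (∫ x, SGN (y - x) ∂P), fun y => g (∫ x, SGN (y - x) ∂P); Q] := by
  have hmem := hE.memLp_SGN_sub 2 (P.prod Q)
  have hproj := memLp_integral_prod_right one_le_two
    (hmem.comp_measurePreserving (Measure.measurePreserving_swap (μ := Q) (ν := P)))
  have hcond := condExp_comap_snd_ae_eq (hmem.integrable one_le_two)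
  have hlaw := (measurePreserving_snd (μ := P) (ν := Q)).hasLaw
  have hmeas := fun L : StrongDual ℝ (StrongDual ℝ E) => (L.comp_memLp' hproj).aemeasurable
  exact (covariance_dual_of_condExp_ae_eq measurable_snd.comap_le hmem hcond f g).symm.trans
    (hlaw.covariance_fun_comp (hmeas f) (hmeas g))

end Covariance

section FiniteSamples

theorem measurePreserving_restrict_infinitePi {E : Type*} [MeasurableSpace E] (P : Measure E)
    [IsProbabilityMeasure P] (m : ℕ) :
    MeasurePreserving (fun (x : ℕ → E) (i : Fin m) => x i) (Measure.infinitePi fun _ => P)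
      (Measure.pi fun _ => P) := by
  refine ⟨by fun_prop, ?_⟩
  rw [← Measure.infinitePi_eq_pi]
  exact Measure.map_infinitePi_infinitePi_of_inj (P := fun _ : ℕ => P) Fin.val_injective

variable {Ω E : Type*} [MeasurableSpace Ω] [MeasurableSpace E] {ρ : Measure Ω} {P Q : Measure E}
  [IsProbabilityMeasure P] [IsProbabilityMeasure Q]

theorem hasLaw_prodMk_pi_of_iIndepFun_sumElim {ι κ : Type*} [Fintype ι] [Fintype κ]
    {X : ι → Ω → E} {Y : κ → Ω → E} (hX : ∀ i, HasLaw (X i) P ρ) (hY : ∀ j, HasLaw (Y j) Q ρ)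
    (hindep : iIndepFun (Sum.elim X Y) ρ) :
    HasLaw (fun ω => ((fun i => X i ω), fun j => Y j ω))
      ((Measure.pi fun _ => P).prod (Measure.pi fun _ => Q)) ρ := by
  have hlaw : ∀ s, HasLaw (Sum.elim X Y s) (Sum.elim (fun _ => P) (fun _ => Q) s) ρ := by
    rintro (i | j)
    exacts [hX i, hY j]
  have : ∀ s : ι ⊕ κ,
      IsProbabilityMeasure (Sum.elim (fun _ => P) (fun _ => Q) s : Measure E) := by
    rintro (i | j) <;> simpa
  exact (measurePreserving_sumPiEquivProdPi (X := fun _ : ι ⊕ κ => E)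
    (Sum.elim (fun _ => P) (fun _ => Q))).comp_hasLaw (hindep.hasLaw_pi hlaw)

theorem identDistrib_samples_twoSampleMeasure {m n : ℕ} {X : Fin m → Ω → E} {Y : Fin n → Ω → E}
    (hX : ∀ i, HasLaw (X i) P ρ) (hY : ∀ j, HasLaw (Y j) Q ρ)
    (hindep : iIndepFun (Sum.elim X Y) ρ) :
    IdentDistrib (fun ω => ((fun i => X i ω), fun j => Y j ω))
      (fun z : (ℕ → E) × (ℕ → E) => ((fun i : Fin m => z.1 i), fun j : Fin n => z.2 j))
      ρ (twoSampleMeasure P Q) :=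
  (hasLaw_prodMk_pi_of_iIndepFun_sumElim hX hY hindep).identDistrib
    ((measurePreserving_restrict_infinitePi P m).prod
      (measurePreserving_restrict_infinitePi Q n)).hasLaw

theorem tendstoInDistribution_congr_identDistrib {ι Ω' Ω'' F : Type*} {Ω : ι → Type*}
    [∀ i, MeasurableSpace (Ω i)] [MeasurableSpace Ω'] [MeasurableSpace Ω''] [TopologicalSpace F]
    [MeasurableSpace F] [OpensMeasurableSpace F] {ρ : ∀ i, Measure (Ω i)}
    [∀ i, IsProbabilityMeasure (ρ i)] {μ : Measure Ω'} [IsProbabilityMeasure μ]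
    {ν : Measure Ω''} [IsProbabilityMeasure ν] {l : Filter ι} {S : ∀ i, Ω i → F}
    {T : ι → Ω' → F} {Z : Ω'' → F} (hST : ∀ i, IdentDistrib (S i) (T i) (ρ i) μ)
    (hT : TendstoInDistribution T l Z (fun _ => μ) ν) : TendstoInDistribution S l Z ρ ν :=
  ⟨fun i => (hST i).aemeasurable_fst, hT.aemeasurable_limit,
    hT.tendsto.congr fun i => Subtype.ext (hST i).map_eq.symm⟩

end FiniteSamples

section WMWStatistic

variable {E : Type u} [NormedAddCommGroup E] [NormedSpace ℝ E]

theorem wmwStat_eq_twoSampleUStat (m n : ℕ) (z : (ℕ → E) × (ℕ → E)) :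
    wmwStat (fun i : Fin m => z.1 i) (fun j : Fin n => z.2 j)
      = twoSampleUStat (fun z : E × E => SGN (z.2 - z.1)) m n z := by
  simp only [wmwStat, twoSampleUStat, Finset.sum_range]

theorem IsSmoothSpace.measurable_wmwStat [MeasurableSpace E] [BorelSpace E]
    [TopologicalSpace.SeparableSpace (StrongDual ℝ E)] (hE : IsSmoothSpace E) (m n : ℕ) :
    Measurable fun w : (Fin m → E) × (Fin n → E) => wmwStat w.1 w.2 := by
  have := separableSpace_of_separableSpace_strongDual E
  have := UniformSpace.secondCountable_of_separable E
  have := UniformSpace.secondCountable_of_separable (StrongDual ℝ E)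
  have hSGN := hE.measurable_SGN
  unfold wmwStat
  fun_prop

end WMWStatistic

theorem theorem1_general {E : Type u} [NormedAddCommGroup E] [NormedSpace ℝ E]
    [MeasurableSpace E] [BorelSpace E] (hsmooth : IsSmoothSpace E)
    (hsep : TopologicalSpace.SeparableSpace (StrongDual ℝ E)) (htype : IsTypeTwo (StrongDual ℝ E))
    (P Q : Measure E) [IsProbabilityMeasure P] [IsProbabilityMeasure Q] {ι : Type*}
    {l : Filter ι} [l.NeBot] [l.IsCountablyGenerated] (m n : ι → ℕ) (γ : ℝ)
    (hm : Tendsto m l atTop) (hn : Tendsto n l atTop)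
    (hmn : Tendsto (fun k => (m k : ℝ) / ((m k : ℝ) + (n k : ℝ))) l (𝓝 γ))
    {Ω : ι → Type v} [∀ k, MeasurableSpace (Ω k)]
    (ρ : (k : ι) → Measure (Ω k)) [∀ k, IsProbabilityMeasure (ρ k)]
    (X : (k : ι) → Fin (m k) → Ω k → E) (Y : (k : ι) → Fin (n k) → Ω k → E)
    (hX : ∀ k i, HasLaw (X k i) P (ρ k)) (hY : ∀ k j, HasLaw (Y k j) Q (ρ k))
    (hindep : ∀ k, iIndepFun (Sum.elim (X k) (Y k)) (ρ k)) :
    ∃ G : ProbabilityMeasure (StrongDual ℝ E),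
      IsGaussianWith (G : Measure (StrongDual ℝ E)) 0
        (fun f g => (1 - γ) * Gamma₁ P Q f g + γ * Gamma₂ P Q f g) ∧
      TendstoInDistribution
        (fun k ω => Real.sqrt ((m k : ℝ) * (n k : ℝ) / ((m k : ℝ) + (n k : ℝ))) •
          (wmwStat (fun i => X k i ω) (fun j => Y k j ω) - wmwMean P Q))
        l id ρ (G : Measure (StrongDual ℝ E)) := by
  have := UniformSpace.secondCountable_of_separable (StrongDual ℝ E)
  obtain ⟨G, hG, hlim⟩ := htype.exists_tendstoInDistribution_twoSampleUStat
    (hsmooth.memLp_SGN_sub 2 (P.prod Q)) hm hn hmn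
  simp only [← hsmooth.Gamma₁_eq_covariance P Q, ← hsmooth.Gamma₂_eq_covariance P Q] at hG
  refine ⟨G, hG, tendstoInDistribution_congr_identDistrib (fun k => ?_) hlim⟩
  have hstat := ((hsmooth.measurable_wmwStat (m k) (n k)).sub_const (wmwMean P Q)).const_smul
    √((m k : ℝ) * n k / (m k + n k))
  simp only [← wmwStat_eq_twoSampleUStat]
  exact (identDistrib_samples_twoSampleMeasure (hX k) (hY k) (hindep k)).comp hstat

theorem theorem1 {E : Type u} [NormedAddCommGroup E] [NormedSpace ℝ E] [CompleteSpace E]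
    [MeasurableSpace E] [BorelSpace E]
    (hsmooth : IsSmoothSpace E)
    (hsep : TopologicalSpace.SeparableSpace (StrongDual ℝ E))
    (htype : IsTypeTwo (StrongDual ℝ E))
    (P Q : Measure E) [IsProbabilityMeasure P] [IsProbabilityMeasure Q]
    (m n : ℕ → ℕ) (γ : ℝ) (hγ : γ ∈ Set.Ioo (0 : ℝ) 1)
    (hm : Tendsto m atTop atTop) (hn : Tendsto n atTop atTop)
    (hmn : Tendsto (fun k => (m k : ℝ) / ((m k : ℝ) + (n k : ℝ))) atTop (𝓝 γ))
    {Ω : ℕ → Type v} [∀ k, MeasurableSpace (Ω k)]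
    (ρ : (k : ℕ) → Measure (Ω k)) [∀ k, IsProbabilityMeasure (ρ k)]
    (X : (k : ℕ) → Fin (m k) → Ω k → E) (Y : (k : ℕ) → Fin (n k) → Ω k → E)
    (hX : ∀ k i, HasLaw (X k i) P (ρ k)) (hY : ∀ k j, HasLaw (Y k j) Q (ρ k))
    (hindep : ∀ k, iIndepFun (Sum.elim (X k) (Y k)) (ρ k)) :
    ∃ G : ProbabilityMeasure (StrongDual ℝ E),
      IsGaussianWith (G : Measure (StrongDual ℝ E)) 0
        (fun f g => (1 - γ) * Gamma₁ P Q f g + γ * Gamma₂ P Q f g) ∧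
      TendstoInDistribution
        (fun k ω => Real.sqrt ((m k : ℝ) * (n k : ℝ) / ((m k : ℝ) + (n k : ℝ))) •
          (wmwStat (fun i => X k i ω) (fun j => Y k j ω) - wmwMean P Q))
        atTop id ρ (G : Measure (StrongDual ℝ E)) := by
  exact theorem1_general hsmooth hsep htype P Q m n γ hm hn hmn ρ X Y hX hY hindep
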